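/- Setting (single-pass streaming stochastic bandits). There are $n$ arms arriving one by one in a stream; arm $i$ has i.i.d. Bernoulli rewards with unknown mean $\mu_i\in[0,1]$. At every time at most $m$ arms, with their statistics, may be stored; a discarded arm and its statistics are lost, and in each of $T$ rounds exactly one stored arm is pulled. Write $\mu_*=\max_i\mu_i$, $\Delta_i=\mu_*-\mu_i$, and let $\mathbb E[R(T)]=\mathbb E\big[\sum_{t=1}^T(\mu_*-\mu_{A_t})\big]$ be the expected regret, where $A_t$ is the arm pulled in round $t$. Algorithm. Let $\alpha\ge 1$ be real, $\tfrac23 n\le m\le n-1$, $c=n-m$, and $L=\Big\lceil\big(\tfrac{2\alpha}{e}\big)^{\frac{\alpha}{\alpha+1}}\big(\tfrac Tn\big)^{\frac1{\alpha+1}}\Big\rceil$. (1) Read the first $m$ arms of the stream and draw an ordered sample $(s_1,\dots,s_{2c})$ of $2c$ distinct arms among them, uniformly at random. (2) For $i=1,\dots,c$: pull each of $s_{2i-1},s_{2i}$ exactly $L$ times and discard the one with the smaller empirical mean. (3) Read the remaining $c$ arms of the stream; on the $m$ arms now stored run UCB$(\delta)$, started afresh, in all remaining rounds: pull an arm maximizing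 $\hat\mu_i+\sqrt{2\log(1/\delta)/T_i}$ (equal to $\infty$ if $T_i=0$), where $T_i$ and $\hat\mu_i$ are the number of pulls and the empirical mean of arm $i$ so far in this phase; the confidence parameter $\delta$ is any number with $T^{-2}\le\delta\le T^{-1}$. Ties are broken by an arbitrary rule. Theorem. There is an absolute constant $C>0$ such that for every real $\alpha\ge1$ and all integers $n,m$ with $\tfrac23n\le m\le n-1$ there is $T_0=T_0(\alpha,n,m)$ such that for every $T\ge T_0$, every such $\delta$ and every tie-breaking rule, the algorithm never stores more than $m$ arms, and on every Bernoulli instance $(\mu_1,\dots,\mu_n)\in[0,1]^n$ its expected regret satisfies $$\mathbb E[R(T)]\;\le\; C\Big(\frac{2\alpha}{e}\Big)^{\frac{\alpha}{\alpha+1}}\,\frac{(n-m)\,T^{\frac1{\alpha+1}}}{n^{1+\frac1{\alpha+1}}}\sum_{i:\Delta_i>0}\Delta_i^{1-2\alpha}.$$ -/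

import Mathlib

open MeasureTheory ProbabilityTheory

/-! ## Single-pass streaming bandits -/

/-- The statistics kept with an arm in memory: the number of recorded pulls and the number of
those pulls with reward `1`. -/
structure ArmStat where
  pulls : ℕ
  wins : ℕ

/-- The empirical mean of the recorded pulls. -/
noncomputable def ArmStat.mean (s : ArmStat) : ℝ := (s.wins : ℝ) / (s.pulls : ℝ)

/-- Record one more pull with reward `b`. -/
def ArmStat.record (s : ArmStat) (b : Bool) : ArmStat :=
  ⟨s.pulls + 1, s.wins + (if b then 1 else 0)⟩

/-- The memory of the player. Arm `i : Fin n` is the arm in position `i` of the stream;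
`stat i = none` means that arm `i` is not stored, and `read` is the number of arms that have been
read from the stream so far. -/
structure Memory (n : ℕ) where
  stat : Fin n → Option ArmStat
  read : ℕ

/-- The set of arms that are stored. -/
def Memory.held {n : ℕ} (M : Memory n) : Finset (Fin n) :=
  Finset.univ.filter fun i => (M.stat i).isSome = true

/-- The statistics of arm `i` (a default value if `i` is not stored). -/
def Memory.statOf {n : ℕ} (M : Memory n) (i : Fin n) : ArmStat :=
  (M.stat i).getD ⟨0, 0⟩

/-- The empty memory at the start of the game. -/
def Memory.empty (n : ℕ) : Memory n := ⟨fun _ => none, 0⟩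

/-- The storage stage of a round: the arms in `D` are discarded, the statistics of the
arms that remain are erased if `clear` is set, and then the next `k` arms of the stream are read.
An arm can enter the memory only when the stream reaches its position. -/
def Memory.manage {n : ℕ} (M : Memory n) (D : Finset (Fin n)) (clear : Bool) (k : ℕ) :
    Memory n where
  stat := fun i =>
    if M.read ≤ (i : ℕ) ∧ (i : ℕ) < M.read + k then some ⟨0, 0⟩
    else if i ∈ D then none
    else (M.stat i).map fun s => if clear then ⟨0, 0⟩ else s
  read := M.read + k

/-- Arm `i` was pulled with reward `b`: update its statistics. -/
def Memory.observe {n : ℕ} (M : Memory n) (i : Fin n) (b : Bool) : Memory n where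
  stat := fun j => if j = i then (M.stat j).map fun s => s.record b else M.stat j
  read := M.read

/-- A single-pass streaming strategy for `n` arms. Its choices in a round depend on the index of the
round (counted from `0`), on its internal randomness, and on the current memory only.
In each round it first chooses arms to discard, whether to erase the statistics, and a number of arms
to read; then, in view of the resulting memory, it chooses one arm to pull. -/
structure StreamingStrategy (n : ℕ) (Seed : Type) where
  discard : ℕ → Seed → Memory n → Finset (Fin n)
  clear : ℕ → Seed → Memory n → Bool
  readCount : ℕ → Seed → Memory n → ℕ
  pull : ℕ → Seed → Memory n → Fin n

namespace StreamingStrategy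

variable {n : ℕ} {Seed : Type}

/-- The memory after the storage stage of round `t`, if it was `M` at the start of the round. -/
def afterStorage (A : StreamingStrategy n Seed) (s : Seed) (t : ℕ) (M : Memory n) : Memory n :=
  M.manage (A.discard t s M) (A.clear t s M) (A.readCount t s M)

/-- The memory at the start of round `t`, with internal randomness `s`, when `r t i` is the reward
that arm `i` yields if it is pulled in round `t`. -/
def memoryAt (A : StreamingStrategy n Seed) (s : Seed) (r : ℕ → Fin n → Bool) : ℕ → Memory n
  | 0 => Memory.empty n
  | t + 1 =>
    let M := A.afterStorage s t (A.memoryAt s r t)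
    M.observe (A.pull t s M) (r t (A.pull t s M))

/-- The memory from which an arm is pulled in round `t`. -/
def pullMemory (A : StreamingStrategy n Seed) (s : Seed) (r : ℕ → Fin n → Bool) (t : ℕ) :
    Memory n :=
  A.afterStorage s t (A.memoryAt s r t)

/-- The arm pulled in round `t`. -/
def armAt (A : StreamingStrategy n Seed) (s : Seed) (r : ℕ → Fin n → Bool) (t : ℕ) : Fin n :=
  A.pull t s (A.pullMemory s r t)

/-- During the first `T` rounds, the strategy never stores more than `m` arms, and it pulls only
arms that are stored. -/
def UsesMemory (A : StreamingStrategy n Seed) (m T : ℕ) : Prop :=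
  ∀ (s : Seed) (r : ℕ → Fin n → Bool) (t : ℕ), t < T →
    (A.pullMemory s r t).held.card ≤ m ∧ A.armAt s r t ∈ (A.pullMemory s r t).held

end StreamingStrategy

/-! ## Regret on Bernoulli instances -/

/-- The mean of the best arm of the instance `μ`. -/
noncomputable def bestMean {n : ℕ} (μ : Fin n → unitInterval) : ℝ := ⨆ i, (μ i : ℝ)

/-- The gap of arm `i`. -/
noncomputable def gap {n : ℕ} (μ : Fin n → unitInterval) (i : Fin n) : ℝ :=
  bestMean μ - (μ i : ℝ)

/-- The law of the table of rewards: all entries are independent, and those of arm `i` have the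
Bernoulli distribution with mean `μ i`. -/
noncomputable def rewardLaw {n : ℕ} (μ : Fin n → unitInterval) :
    Measure (ℕ → Fin n → Bool) :=
  Measure.infinitePi fun _ : ℕ => Measure.pi fun i : Fin n => bernoulliMeasure true false (μ i)

/-- The regret of the first `T` rounds, as a random variable. -/
noncomputable def StreamingStrategy.regret {n : ℕ} {Seed : Type} (A : StreamingStrategy n Seed)
    (μ : Fin n → unitInterval) (T : ℕ) (ω : Seed × (ℕ → Fin n → Bool)) : ℝ :=
  ∑ t ∈ Finset.range T, (bestMean μ - (μ (A.armAt ω.1 ω.2 t) : ℝ))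

/-! ## The algorithm: pairwise elimination, then UCB -/

/-- The elements of `S` at which `f` is maximal. -/
noncomputable def argmaxSet {n : ℕ} {β : Type} [LE β] (S : Finset (Fin n)) (f : Fin n → β) :
    Finset (Fin n) :=
  open Classical in S.filter fun i => ∀ j ∈ S, f j ≤ f i

/-- The upper confidence bound computed from the statistics `s` with confidence parameter `δ`. -/
noncomputable def ucbIndex (δ : ℝ) (s : ArmStat) : EReal :=
  if s.pulls = 0 then ⊤
  else ((s.mean + √(2 * Real.log (1 / δ) / (s.pulls : ℝ)) : ℝ) : EReal)

/-- The number of pulls of each sampled arm in the elimination phase (rounded up). -/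
noncomputable def elimPulls (α : ℝ) (n T : ℕ) : ℕ :=
  ⌈(2 * α / Real.exp 1) ^ (α / (α + 1)) * ((T : ℝ) / (n : ℝ)) ^ (1 / (α + 1))⌉₊

/-- The random choice of the algorithm: an ordered sample, without replacement, of `2 (n - m)` of
the first `m` arms of the stream. -/
def PairSample (n m : ℕ) : Type := Fin (2 * (n - m)) ↪ {i : Fin n // (i : ℕ) < m}

instance PairSample.instMeasurableSpace (n m : ℕ) : MeasurableSpace (PairSample n m) := ⊤

/-- The uniform distribution on ordered samples. -/
noncomputable def pairSampleLaw (n m : ℕ) : Measure (PairSample n m) := uniformOn Set.univ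

/-- The `k`-th sampled arm. -/
def PairSample.arm {n m : ℕ} (s : PairSample n m) (k : Fin (2 * (n - m))) : Fin n :=
  (s.toFun k : Fin n)

/-- The algorithm, for `n` arms, memory size `m` and horizon `T`, with `L = elimPulls α n T`.
It reads the first `m` arms in round `0`. In the rounds `k L, …, k L + L - 1`, for
`k < 2 (n - m)`, it pulls the `k`-th sampled arm. As soon as both arms of a pair
`{2 j, 2 j + 1}` of the sample have been pulled `L` times, the one with the smaller empirical mean is
discarded. In round `2 (n - m) L` it reads the other `n - m` arms, and from then on it runs UCB,
started afresh, on the arms in memory. Ties in round `t` are broken by `tie t`. -/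
noncomputable def elimUCB (α : ℝ) (n m T : ℕ) (δ : ℝ) (tie : ℕ → Finset (Fin n) → Fin n) :
    StreamingStrategy n (PairSample n m) where
  discard := fun t s M =>
    (Finset.univ.filter fun j : Fin (n - m) => t = 2 * elimPulls α n T * (j + 1)).image fun (j : Fin (n - m)) =>
      tie t (argmaxSet {s.arm ⟨2 * j, by omega⟩, s.arm ⟨2 * j + 1, by omega⟩}
        fun i => -(M.statOf i).mean)
  clear := fun t _ _ => decide (t = elimPulls α n T * (2 * (n - m)))
  readCount := fun t _ _ =>
    if t = 0 then m else if t = elimPulls α n T * (2 * (n - m)) then n - m else 0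
  pull := fun t s M =>
    if h : t < elimPulls α n T * (2 * (n - m)) then
      s.arm ⟨t / elimPulls α n T, Nat.div_lt_of_lt_mul h⟩
    else tie t (argmaxSet M.held fun i => ucbIndex δ (M.statOf i))

/-!
The regret is paid in three places.

*Elimination.* A sampled arm is uniformly distributed over the first `m` arms, so the
`2 (n - m) L` pulls of this phase cost at most `2 (n - m) L / m` times the sum of the gaps.

*Loss of the optimal arm.* Fix an optimal arm. It is lost only if it is sampled and beaten by its
partner. Given a partner of gap `g` this has probability at most `exp (-L g ^ 2)`, and then the
partner stays in memory, so that from then on the best stored arm has gap at most `g`, which costs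
`O (T g)`. An ordered pair of distinct arms has probability `1 / (m (m - 1))` at given positions of
the sample. Since `exp (-y) ≤ (α / e) ^ α y ^ (-α)`, the value of `L` makes
`T g exp (-L g ^ 2)` at most of order `n L g ^ (1 - 2 α)` (`mul_gap_mul_exp_le`), which matches the
cost of the elimination.

*UCB.* With a stored arm of gap `g` as benchmark, the arms of gap at most `2 g` cost at most `2 T g`
altogether, which is part of the previous item; the other arms have a gap to the benchmark of at
least half of their gap, and the usual argument bounds their regret by `O (log T)` over their gap
(`regret_le`). For large `T` the sum of these terms is below a fixed multiple of the main term,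
because `log T` is dominated by `T ^ (1 / (α + 1))`.

The rewards are given as a table indexed by rounds, so the rewards of an arm are collected at random
times. All deviation probabilities therefore come from one Hoeffding bound for predictable weighted
sums of rewards (`measureReal_weighted_sum_ge_le`), proved with an exponential supermartingale.
-/

/-! ### Concentration for rewards collected by a non-anticipating rule -/

/-- The centred reward of arm `i` in a row `y` of the reward table. -/
noncomputable def centredReward {n : ℕ} (μ : Fin n → unitInterval) (y : Fin n → Bool)
    (i : Fin n) : ℝ :=
  (if y i then 1 else 0) - (μ i : ℝ)

instance rewardLaw.instIsProbabilityMeasure {n : ℕ} (μ : Fin n → unitInterval) :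
    IsProbabilityMeasure (rewardLaw μ) := by
  unfold rewardLaw; infer_instance

/-- A function of the reward table that depends on the rounds before `t` only is a function of a
finite table. -/
lemma DependsOn.exists_eq_comp_restrict {n : ℕ} {β : Type*} [Nonempty β] {t : ℕ}
    {f : (ℕ → Fin n → Bool) → β} (hf : DependsOn f (Set.Iio t)) :
    ∃ g : (Finset.range t → Fin n → Bool) → β, f = fun r => g ((Finset.range t).restrict r) := by
  have h : Function.FactorsThrough f (Finset.range t).restrict := by
    intro x y hxy
    refine hf fun i hi => ?_
    exact congrFun hxy ⟨i, Finset.mem_range.2 hi⟩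
  obtain ⟨g, hg⟩ := (Function.factorsThrough_iff f).1 h
  exact ⟨g, hg⟩

lemma DependsOn.measurable_rewardTable {n : ℕ} {β : Type*} [Nonempty β] [MeasurableSpace β] {t : ℕ}
    {f : (ℕ → Fin n → Bool) → β} (hf : DependsOn f (Set.Iio t)) : Measurable f := by
  obtain ⟨g, rfl⟩ := hf.exists_eq_comp_restrict
  exact (Measurable.of_discrete (f := g)).comp (Finset.measurable_restrict _)

lemma DependsOn.integrable_rewardTable {n : ℕ} {μ : Fin n → unitInterval} {t : ℕ}
    {f : (ℕ → Fin n → Bool) → ℝ} (hf : DependsOn f (Set.Iio t)) :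
    Integrable f (rewardLaw μ) := by
  have hm := hf.measurable_rewardTable
  obtain ⟨g, rfl⟩ := hf.exists_eq_comp_restrict
  have : Integrable g ((rewardLaw μ).map (Finset.range t).restrict) := by
    have := Measure.isProbabilityMeasure_map (μ := rewardLaw μ)
      (Finset.measurable_restrict (X := fun _ : ℕ => Fin n → Bool) (Finset.range t)).aemeasurable
    exact Integrable.of_finite
  exact this.comp_measurable (Finset.measurable_restrict _)

/-- The rewards of round `t` are independent of the past: they can be integrated out first. -/
lemma integral_eq_integral_integral_row {n : ℕ} (μ : Fin n → unitInterval) {t : ℕ}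
    {F : (ℕ → Fin n → Bool) → (Fin n → Bool) → ℝ} (hF : DependsOn F (Set.Iio t)) :
    ∫ r, F r (r t) ∂(rewardLaw μ) =
      ∫ r, (∫ y, F r y ∂(Measure.pi fun i => bernoulliMeasure true false (μ i)))
        ∂(rewardLaw μ) := by
  obtain ⟨g, rfl⟩ := hF.exists_eq_comp_restrict
  set ρ : Measure (Fin n → Bool) := Measure.pi fun i => bernoulliMeasure true false (μ i) with hρ
  have hmr := Finset.measurable_restrict (X := fun _ : ℕ => Fin n → Bool) (Finset.range t)
  have hme : Measurable fun r : ℕ → Fin n → Bool => r t := measurable_pi_apply t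
  have hindep : IndepFun (Finset.range t).restrict (fun r : ℕ → Fin n → Bool => r t)
      (rewardLaw μ) := by
    have h := (iIndepFun_infinitePi (P := fun _ : ℕ => ρ)
      (X := fun _ (y : Fin n → Bool) => y) (fun _ => measurable_id)).indepFun_finset
      (Finset.range t) {t} (by simp) (fun i => measurable_pi_apply i)
    have hev : Measurable fun z : ({t} : Finset ℕ) → Fin n → Bool =>
        z ⟨t, Finset.mem_singleton_self t⟩ := measurable_pi_apply _
    exact h.comp measurable_id hev
  have hmap : (rewardLaw μ).map (fun r => ((Finset.range t).restrict r, r t)) =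
      ((rewardLaw μ).map (Finset.range t).restrict).prod ρ := by
    rw [(indepFun_iff_map_prod_eq_prod_map_map hmr.aemeasurable hme.aemeasurable).1 hindep]
    congr 1
    exact Measure.infinitePi_map_eval (fun _ : ℕ => ρ) t
  have := Measure.isProbabilityMeasure_map (μ := rewardLaw μ) hmr.aemeasurable
  have h1 : ∫ r, g ((Finset.range t).restrict r) (r t) ∂(rewardLaw μ) =
      ∫ z, g z.1 z.2 ∂(((rewardLaw μ).map (Finset.range t).restrict).prod ρ) := by
    rw [← hmap, integral_map (hmr.prodMk hme).aemeasurable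
      (Measurable.of_discrete (f := fun z : (Finset.range t → Fin n → Bool) × (Fin n → Bool) =>
        g z.1 z.2)).aestronglyMeasurable]
  rw [h1, integral_prod _ Integrable.of_finite, integral_map hmr.aemeasurable
    Measurable.of_discrete.aestronglyMeasurable]

/-- Hoeffding's lemma for a Bernoulli reward. -/
lemma integral_exp_centredReward_le {n : ℕ} (μ : Fin n → unitInterval) (i : Fin n) (c : ℝ) :
    ∫ y, Real.exp (c * centredReward μ y i)
      ∂(Measure.pi fun i => bernoulliMeasure true false (μ i)) ≤ Real.exp (c ^ 2 / 8) := by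
  have hmap : (Measure.pi fun i => bernoulliMeasure true false (μ i)).map (Function.eval i) =
      bernoulliMeasure true false (μ i) := (measurePreserving_eval _ i).map_eq
  have h1 : ∫ y, Real.exp (c * centredReward μ y i)
      ∂(Measure.pi fun i => bernoulliMeasure true false (μ i)) =
      ∫ b, Real.exp (c * ((if b then 1 else 0) - (μ i : ℝ)))
        ∂(bernoulliMeasure true false (μ i)) := by
    rw [← hmap, integral_map (measurable_pi_apply i).aemeasurable
      Measurable.of_discrete.aestronglyMeasurable]
    rfl
  have h2 : HasSubgaussianMGF
      (fun b : Bool => (if b then 1 else 0 : ℝ) -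
        ∫ b : Bool, (if b then 1 else 0 : ℝ) ∂(bernoulliMeasure true false (μ i)))
      ((‖(1 : ℝ) - 0‖₊ / 2) ^ 2) (bernoulliMeasure true false (μ i)) :=
    hasSubgaussianMGF_of_mem_Icc Measurable.of_discrete.aemeasurable
      (.of_forall fun b => by cases b <;> simp)
  have h3 := h2.mgf_le c
  rw [integral_bernoulliMeasure] at h3
  simp only [mgf, if_true, smul_eq_mul, Bool.false_eq_true, if_false, mul_one, mul_zero, add_zero]
    at h3
  rw [h1]
  refine h3.trans (le_of_eq ?_)
  congr 1
  simp
  ring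

/-- The exponential supermartingale of a predictable weighted sum of rewards. In round `u` the
arm `a u` is observed with weight `w u`, where both are determined by the earlier rounds. -/
lemma integral_exp_weighted_sum_le_one {n : ℕ} (μ : Fin n → unitInterval)
    {a : ℕ → (ℕ → Fin n → Bool) → Fin n} {w : ℕ → (ℕ → Fin n → Bool) → ℝ}
    (ha : ∀ u, DependsOn (a u) (Set.Iio u)) (hw : ∀ u, DependsOn (w u) (Set.Iio u)) (t : ℕ) :
    ∫ r, Real.exp (∑ u ∈ Finset.range t,
      (w u r * centredReward μ (r u) (a u r) - w u r ^ 2 / 8)) ∂(rewardLaw μ) ≤ 1 := by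
  set S : ℕ → (ℕ → Fin n → Bool) → ℝ := fun t r => ∑ u ∈ Finset.range t,
      (w u r * centredReward μ (r u) (a u r) - w u r ^ 2 / 8) with hS
  have hSdep : ∀ t, DependsOn (S t) (Set.Iio t) := by
    intro t x y hxy
    refine Finset.sum_congr rfl fun u hu => ?_
    have hu' := Finset.mem_range.1 hu
    rw [ha u (fun i hi => hxy i (lt_trans hi hu')), hw u (fun i hi => hxy i (lt_trans hi hu')),
      hxy u hu']
  induction t with
  | zero => simp
  | succ t ih =>
    refine le_trans ?_ ih
    have h0 : ∀ r, Real.exp (S (t + 1) r) = (fun (r : ℕ → Fin n → Bool) (y : Fin n → Bool) =>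
        Real.exp (S t r) * (Real.exp (w t r * centredReward μ y (a t r)) *
          Real.exp (-(w t r ^ 2 / 8)))) r (r t) := by
      intro r
      simp only [hS, Finset.sum_range_succ]
      rw [Real.exp_add, sub_eq_add_neg _ (w t r ^ 2 / 8),
        Real.exp_add (w t r * centredReward μ (r t) (a t r))]
    have hdep : DependsOn (fun (r : ℕ → Fin n → Bool) (y : Fin n → Bool) =>
        Real.exp (S t r) * (Real.exp (w t r * centredReward μ y (a t r)) *
          Real.exp (-(w t r ^ 2 / 8)))) (Set.Iio t) := by
      intro x y hxy
      funext z
      simp only [hSdep t hxy, ha t hxy, hw t hxy]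
    change ∫ r, Real.exp (S (t + 1) r) ∂(rewardLaw μ) ≤ ∫ r, Real.exp (S t r) ∂(rewardLaw μ)
    simp_rw [h0]
    rw [integral_eq_integral_integral_row μ hdep]
    refine integral_mono ?_ ?_ ?_
    · refine DependsOn.integrable_rewardTable (t := t) fun x y hxy => ?_
      have := hdep hxy
      exact congrArg (fun G : (Fin n → Bool) → ℝ => ∫ z, G z ∂_) this
    · refine DependsOn.integrable_rewardTable (t := t) fun x y hxy => ?_
      simp only [hSdep t hxy]
    · intro r
      simp only
      rw [integral_const_mul, integral_mul_const]
      have := integral_exp_centredReward_le μ (a t r) (w t r)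
      calc _ ≤ Real.exp (S t r) * (Real.exp (w t r ^ 2 / 8) * Real.exp (-(w t r ^ 2 / 8))) := by
            gcongr
        _ = Real.exp (S t r) := by rw [← Real.exp_add]; simp

/-- A Hoeffding bound for predictable weighted sums of rewards, on the event that the sum of the
squared weights is at most `v`. The rewards may be collected adaptively. -/
lemma measureReal_weighted_sum_ge_le {n : ℕ} (μ : Fin n → unitInterval)
    {a : ℕ → (ℕ → Fin n → Bool) → Fin n} {w : ℕ → (ℕ → Fin n → Bool) → ℝ}
    (ha : ∀ u, DependsOn (a u) (Set.Iio u)) (hw : ∀ u, DependsOn (w u) (Set.Iio u)) (t : ℕ)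
    {x v : ℝ} (hx : 0 ≤ x) (hv : 0 < v) :
    (rewardLaw μ).real {r | x ≤ ∑ u ∈ Finset.range t, w u r * centredReward μ (r u) (a u r) ∧
      ∑ u ∈ Finset.range t, w u r ^ 2 ≤ v} ≤ Real.exp (-(2 * x ^ 2 / v)) := by
  -- the Chernoff exponent `l = 4 x / v` minimizes `-l x + l ^ 2 v / 8`
  set l : ℝ := 4 * x / v with hl
  have hl0 : 0 ≤ l := by positivity
  set Z : (ℕ → Fin n → Bool) → ℝ := fun r => Real.exp (∑ u ∈ Finset.range t,
      ((l * w u r) * centredReward μ (r u) (a u r) - (l * w u r) ^ 2 / 8)) with hZ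
  have hlw : ∀ u, DependsOn (fun r => l * w u r) (Set.Iio u) := fun u x y hxy => by
    simp only [hw u hxy]
  have hZ1 : ∫ r, Z r ∂(rewardLaw μ) ≤ 1 := integral_exp_weighted_sum_le_one μ ha hlw t
  have hZint : Integrable Z (rewardLaw μ) := by
    refine DependsOn.integrable_rewardTable (t := t) fun x y hxy => ?_
    simp only [hZ]
    congr 1
    refine Finset.sum_congr rfl fun u hu => ?_
    have hu' := Finset.mem_range.1 hu
    rw [ha u (fun i hi => hxy i (lt_trans hi hu')), hw u (fun i hi => hxy i (lt_trans hi hu')),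
      hxy u hu']
  have hsub : {r | x ≤ ∑ u ∈ Finset.range t, w u r * centredReward μ (r u) (a u r) ∧
      ∑ u ∈ Finset.range t, w u r ^ 2 ≤ v} ⊆ {r | Real.exp (2 * x ^ 2 / v) ≤ Z r} := by
    rintro r ⟨h1, h2⟩
    simp only [Set.mem_ofPred_eq, hZ, Real.exp_le_exp]
    have h3 : ∑ u ∈ Finset.range t,
        ((l * w u r) * centredReward μ (r u) (a u r) - (l * w u r) ^ 2 / 8) =
        l * ∑ u ∈ Finset.range t, w u r * centredReward μ (r u) (a u r) -
          l ^ 2 / 8 * ∑ u ∈ Finset.range t, w u r ^ 2 := by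
      rw [Finset.mul_sum, Finset.mul_sum, ← Finset.sum_sub_distrib]
      exact Finset.sum_congr rfl fun u _ => by ring
    rw [h3]
    have h4 : l * x ≤ l * ∑ u ∈ Finset.range t, w u r * centredReward μ (r u) (a u r) := by gcongr
    have h5 : l ^ 2 / 8 * ∑ u ∈ Finset.range t, w u r ^ 2 ≤ l ^ 2 / 8 * v := by gcongr
    have h6 : l * x - l ^ 2 / 8 * v = 2 * x ^ 2 / v := by rw [hl]; field_simp; ring
    linarith
  have hmark := mul_meas_ge_le_integral_of_nonneg (.of_forall fun r => (Real.exp_pos _).le)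
    hZint (Real.exp (2 * x ^ 2 / v))
  have h7 : (rewardLaw μ).real {r | Real.exp (2 * x ^ 2 / v) ≤ Z r} ≤
      Real.exp (-(2 * x ^ 2 / v)) := by
    rw [Real.exp_neg, ← one_div, le_div_iff₀ (Real.exp_pos _), mul_comm]
    exact hmark.trans hZ1
  exact (measureReal_mono hsub).trans h7

/-! ### Contents of the memory -/

/-- The number of rounds in `[s, t)` in which arm `i` is pulled, if arm `a u` is pulled in
round `u`. -/
def pullCount {n : ℕ} (a : ℕ → Fin n) (i : Fin n) (s t : ℕ) : ℕ :=
  ((Finset.Ico s t).filter fun u => a u = i).card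

/-- The number of rounds in `[s, t)` in which arm `i` is pulled and yields reward `1`. -/
def winCount {n : ℕ} (a : ℕ → Fin n) (r : ℕ → Fin n → Bool) (i : Fin n) (s t : ℕ) : ℕ :=
  ((Finset.Ico s t).filter fun u => a u = i ∧ r u i = true).card

lemma pullCount_self {n : ℕ} (a : ℕ → Fin n) (i : Fin n) (s : ℕ) : pullCount a i s s = 0 := by
  simp [pullCount]

lemma winCount_self {n : ℕ} (a : ℕ → Fin n) (r : ℕ → Fin n → Bool) (i : Fin n) (s : ℕ) :
    winCount a r i s s = 0 := by
  simp [winCount]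

lemma pullCount_succ {n : ℕ} (a : ℕ → Fin n) (i : Fin n) {s t : ℕ} (h : s ≤ t) :
    pullCount a i s (t + 1) = pullCount a i s t + if a t = i then 1 else 0 := by
  unfold pullCount
  rw [← Finset.insert_Ico_right_eq_Ico_add_one h, Finset.filter_insert]
  split_ifs <;> simp

lemma winCount_succ {n : ℕ} (a : ℕ → Fin n) (r : ℕ → Fin n → Bool) (i : Fin n) {s t : ℕ}
    (h : s ≤ t) :
    winCount a r i s (t + 1) =
      winCount a r i s t + if a t = i ∧ r t i = true then 1 else 0 := by
  unfold winCount
  rw [← Finset.insert_Ico_right_eq_Ico_add_one h, Finset.filter_insert]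
  split_ifs <;> simp

namespace StreamingStrategy

variable {n : ℕ} {Seed : Type}

lemma dependsOn_memoryAt (A : StreamingStrategy n Seed) (s : Seed) (t : ℕ) :
    DependsOn (fun r => A.memoryAt s r t) (Set.Iio t) := by
  induction t with
  | zero => intro x y _; rfl
  | succ t ih =>
    intro x y hxy
    have h1 : A.memoryAt s x t = A.memoryAt s y t :=
      ih fun i hi => hxy i (lt_trans hi (Nat.lt_succ_self t))
    have h2 : x t = y t := hxy t (Nat.lt_succ_self t)
    simp only [memoryAt, h1, h2]

lemma dependsOn_armAt (A : StreamingStrategy n Seed) (s : Seed) (t : ℕ) :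
    DependsOn (fun r => A.armAt s r t) (Set.Iio t) := by
  intro x y hxy
  have h1 := A.dependsOn_memoryAt s t hxy
  simp only at h1
  simp only [armAt, pullMemory, h1]

lemma memoryAt_succ (A : StreamingStrategy n Seed) (s : Seed) (r : ℕ → Fin n → Bool) (t : ℕ) :
    A.memoryAt s r (t + 1) =
      (A.pullMemory s r t).observe (A.armAt s r t) (r t (A.armAt s r t)) := rfl

/-- If the statistics of arm `i` count the pulls since round `u` before a pull, they still do so
after it. -/
lemma memoryAt_succ_stat (A : StreamingStrategy n Seed) (s : Seed) (r : ℕ → Fin n → Bool)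
    {u t : ℕ} (hu : u ≤ t) {i : Fin n} {p : Prop} [Decidable p]
    (h : (A.pullMemory s r t).stat i =
      if p then some ⟨pullCount (A.armAt s r) i u t, winCount (A.armAt s r) r i u t⟩ else none) :
    (A.memoryAt s r (t + 1)).stat i =
      if p then some ⟨pullCount (A.armAt s r) i u (t + 1),
        winCount (A.armAt s r) r i u (t + 1)⟩ else none := by
  rw [memoryAt_succ, pullCount_succ _ _ hu, winCount_succ _ _ _ hu]
  simp only [Memory.observe, h]
  by_cases hp : p <;> by_cases hi : i = A.armAt s r t
  · subst hi; simp [hp, ArmStat.record]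
  · simp [hp, hi, Ne.symm hi]
  · simp [hp]
  · simp [hp]

end StreamingStrategy

section Elimination

variable (α : ℝ) (n m T : ℕ) (δ : ℝ) (tie : ℕ → Finset (Fin n) → Fin n)

/-- The arm that is discarded from the `j`-th pair of the sample. -/
noncomputable def elimLoser (s : PairSample n m) (r : ℕ → Fin n → Bool) (j : Fin (n - m)) : Fin n :=
  tie (2 * elimPulls α n T * (j + 1))
    (argmaxSet {s.arm ⟨2 * j, by omega⟩, s.arm ⟨2 * j + 1, by omega⟩} fun i =>
      -(((elimUCB α n m T δ tie).memoryAt s r (2 * elimPulls α n T * (j + 1))).statOf i).mean)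

/-- The arms that have been discarded by the time an arm is pulled in round `t`. -/
noncomputable def discardedBy (s : PairSample n m) (r : ℕ → Fin n → Bool) (t : ℕ) :
    Finset (Fin n) :=
  (Finset.univ.filter fun j : Fin (n - m) => 2 * elimPulls α n T * (j + 1) ≤ t).image
    (elimLoser α n m T δ tie s r)

variable {α n m T δ tie}

lemma PairSample.arm_injective (s : PairSample n m) : Function.Injective s.arm :=
  fun _ _ h => s.injective (Subtype.ext h)

lemma PairSample.arm_lt (s : PairSample n m) (k : Fin (2 * (n - m))) : (s.arm k : ℕ) < m :=
  (s.toFun k).2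

lemma argmaxSet_nonempty {S : Finset (Fin n)} (hS : S.Nonempty) {β : Type} [LinearOrder β]
    (f : Fin n → β) : (argmaxSet S f).Nonempty := by
  obtain ⟨i, hi, h⟩ := S.exists_max_image f hS
  exact ⟨i, by simpa [argmaxSet] using ⟨hi, h⟩⟩

lemma mem_argmaxSet {S : Finset (Fin n)} {β : Type} [LE β] {f : Fin n → β} {i : Fin n} :
    i ∈ argmaxSet S f ↔ i ∈ S ∧ ∀ j ∈ S, f j ≤ f i := by
  simp [argmaxSet]

lemma elimLoser_mem (htie : ∀ (t : ℕ) (S : Finset (Fin n)), S.Nonempty → tie t S ∈ S)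
    (s : PairSample n m) (r : ℕ → Fin n → Bool) (j : Fin (n - m)) :
    elimLoser α n m T δ tie s r j ∈
      argmaxSet {s.arm ⟨2 * j, by omega⟩, s.arm ⟨2 * j + 1, by omega⟩} fun i =>
      -(((elimUCB α n m T δ tie).memoryAt s r (2 * elimPulls α n T * (j + 1))).statOf i).mean :=
  htie _ _ (argmaxSet_nonempty (by simp) _)

/-- The arm discarded from the `j`-th pair is one of its two arms. -/
lemma elimLoser_eq_arm (htie : ∀ (t : ℕ) (S : Finset (Fin n)), S.Nonempty → tie t S ∈ S)
    (s : PairSample n m) (r : ℕ → Fin n → Bool) (j : Fin (n - m)) :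
    ∃ k : Fin (2 * (n - m)), (k : ℕ) / 2 = j ∧ elimLoser α n m T δ tie s r j = s.arm k := by
  have h := (mem_argmaxSet.1 (elimLoser_mem (α := α) (T := T) (δ := δ) htie s r j)).1
  rcases Finset.mem_insert.1 h with h | h
  · exact ⟨_, by simp, h⟩
  · exact ⟨_, by simp only; omega, Finset.mem_singleton.1 h⟩

lemma elimLoser_injective (htie : ∀ (t : ℕ) (S : Finset (Fin n)), S.Nonempty → tie t S ∈ S)
    (s : PairSample n m) (r : ℕ → Fin n → Bool) :
    Function.Injective (elimLoser α n m T δ tie s r) := by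
  intro j j' h
  obtain ⟨k, hk, h1⟩ := elimLoser_eq_arm (α := α) (T := T) (δ := δ) htie s r j
  obtain ⟨k', hk', h2⟩ := elimLoser_eq_arm (α := α) (T := T) (δ := δ) htie s r j'
  have : k = k' := s.arm_injective (by rw [← h1, ← h2, h])
  subst this
  exact Fin.ext (hk.symm.trans hk')

lemma armAt_of_lt (s : PairSample n m) (r : ℕ → Fin n → Bool) {t : ℕ}
    (ht : t < elimPulls α n T * (2 * (n - m))) :
    (elimUCB α n m T δ tie).armAt s r t =
      s.arm ⟨t / elimPulls α n T, Nat.div_lt_of_lt_mul ht⟩ := by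
  simp only [StreamingStrategy.armAt, elimUCB]
  rw [dif_pos ht]

lemma discardedBy_eq_image (s : PairSample n m) (r : ℕ → Fin n → Bool) {t : ℕ}
    (ht : elimPulls α n T * (2 * (n - m)) ≤ t) :
    discardedBy α n m T δ tie s r t =
      Finset.univ.image (elimLoser α n m T δ tie s r) := by
  unfold discardedBy
  rw [Finset.filter_true_of_mem]
  intro j _
  refine le_trans ?_ ht
  calc 2 * elimPulls α n T * (j + 1) = elimPulls α n T * (2 * (j + 1)) := by ring
    _ ≤ _ := Nat.mul_le_mul_left _ (by omega)

lemma mem_discardedBy_succ (s : PairSample n m) (r : ℕ → Fin n → Bool) (t : ℕ) (i : Fin n) :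
    i ∈ discardedBy α n m T δ tie s r (t + 1) ↔
      i ∈ (elimUCB α n m T δ tie).discard (t + 1) s
        ((elimUCB α n m T δ tie).memoryAt s r (t + 1)) ∨
      i ∈ discardedBy α n m T δ tie s r t := by
  simp only [discardedBy, elimUCB, Finset.mem_image, Finset.mem_filter, Finset.mem_univ, true_and]
  constructor
  · rintro ⟨j, hj, rfl⟩
    rcases Nat.lt_or_ge t (2 * elimPulls α n T * (j + 1)) with h | h
    · left
      have hj' : t + 1 = 2 * elimPulls α n T * (j + 1) := by omega
      refine ⟨j, hj', ?_⟩
      unfold elimLoser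
      rw [← hj']
      rfl
    · exact Or.inr ⟨j, h, rfl⟩
  · rintro (⟨j, hj, rfl⟩ | ⟨j, hj, rfl⟩)
    · refine ⟨j, hj.ge, ?_⟩
      unfold elimLoser
      rw [← hj]
      rfl
    · exact ⟨j, by omega, rfl⟩

lemma lt_of_mem_discardedBy (htie : ∀ (t : ℕ) (S : Finset (Fin n)), S.Nonempty → tie t S ∈ S)
    {s : PairSample n m} {r : ℕ → Fin n → Bool} {t : ℕ} {i : Fin n}
    (hi : i ∈ discardedBy α n m T δ tie s r t) : (i : ℕ) < m := by
  simp only [discardedBy, Finset.mem_image] at hi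
  obtain ⟨j, -, rfl⟩ := hi
  obtain ⟨k, -, h⟩ := elimLoser_eq_arm (α := α) (T := T) (δ := δ) htie s r j
  rw [h]
  exact s.arm_lt k

/-- The memory of the algorithm when an arm is pulled. In the elimination phase it holds the first
`m` arms, in the UCB phase all arms, except those that have been discarded; the statistics count
the pulls since the beginning of the phase. -/
lemma pullMemory_eq (hL : 0 < elimPulls α n T) (hm : m + 1 ≤ n)
    (htie : ∀ (t : ℕ) (S : Finset (Fin n)), S.Nonempty → tie t S ∈ S)
    (s : PairSample n m) (r : ℕ → Fin n → Bool) (t : ℕ) :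
    ((elimUCB α n m T δ tie).pullMemory s r t).read =
        (if t < elimPulls α n T * (2 * (n - m)) then m else n) ∧
      ∀ i, ((elimUCB α n m T δ tie).pullMemory s r t).stat i =
        if (i : ℕ) < (if t < elimPulls α n T * (2 * (n - m)) then m else n) ∧
          i ∉ discardedBy α n m T δ tie s r t then
          some ⟨pullCount ((elimUCB α n m T δ tie).armAt s r) i
              (if t < elimPulls α n T * (2 * (n - m)) then 0 else elimPulls α n T * (2 * (n - m))) t,
            winCount ((elimUCB α n m T δ tie).armAt s r) r i
              (if t < elimPulls α n T * (2 * (n - m)) then 0 else elimPulls α n T * (2 * (n - m))) t⟩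
        else none := by
  set A := elimUCB α n m T δ tie with hA
  set τ := elimPulls α n T * (2 * (n - m)) with hτ
  have hτ0 : 0 < τ := Nat.mul_pos hL (by omega)
  induction t with
  | zero =>
    have hD : discardedBy α n m T δ tie s r 0 = ∅ := by
      simp only [discardedBy, Finset.image_eq_empty]
      refine Finset.filter_false_of_mem fun j _ => ?_
      have : 0 < 2 * elimPulls α n T * ((j : ℕ) + 1) := by positivity
      omega
    refine ⟨?_, fun i => ?_⟩
    · simp [StreamingStrategy.pullMemory, StreamingStrategy.afterStorage, Memory.manage,
        StreamingStrategy.memoryAt, Memory.empty, hA, elimUCB, hτ0]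
    · simp [StreamingStrategy.pullMemory, StreamingStrategy.afterStorage, Memory.manage,
        StreamingStrategy.memoryAt, Memory.empty, hA, elimUCB, hτ0, hD, pullCount_self,
        winCount_self]
  | succ t ih =>
    obtain ⟨ihr, ihs⟩ := ih
    have hread : (A.memoryAt s r (t + 1)).read = if t < τ then m else n := ihr
    have hstat := fun i => A.memoryAt_succ_stat s r (by split_ifs <;> omega) (ihs i)
    have hrc : A.readCount (t + 1) s (A.memoryAt s r (t + 1)) = if t + 1 = τ then n - m else 0 := by
      simp [hA, elimUCB, hτ]
    have hcl : A.clear (t + 1) s (A.memoryAt s r (t + 1)) = decide (t + 1 = τ) := by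
      simp [hA, elimUCB, hτ]
    refine ⟨?_, fun i => ?_⟩
    · simp only [StreamingStrategy.pullMemory, StreamingStrategy.afterStorage, Memory.manage, hrc,
        hread]
      split_ifs <;> omega
    · simp only [mem_discardedBy_succ]
      simp only [StreamingStrategy.pullMemory, StreamingStrategy.afterStorage, Memory.manage, hrc,
        hread, hstat, hcl]
      set D := A.discard (t + 1) s (A.memoryAt s r (t + 1)) with hDdef
      have hin := i.isLt
      rcases lt_trichotomy (t + 1) τ with h | h | h
      · have h1 : t < τ := by omega
        have h2 : ¬ (m ≤ (i : ℕ) ∧ (i : ℕ) < m + 0) := by omega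
        by_cases hiD : i ∈ D <;> simp [h, h1, h.ne, hiD]
      · have h1 : t < τ := by omega
        have h2 : ¬ t + 1 < τ := by omega
        by_cases him : m ≤ (i : ℕ)
        · have h3 : ¬ (i ∈ D ∨ i ∈ discardedBy α n m T δ tie s r t) := by
            rw [← mem_discardedBy_succ]
            exact fun hi => absurd (lt_of_mem_discardedBy htie hi) (by omega)
          have h4 : (i : ℕ) < m + (n - m) := by omega
          simp [h, h1, him, h3, h4, pullCount_self, winCount_self]
        · by_cases hiD : i ∈ D
          · simp [h, h1, him, hiD]
          · by_cases hid : i ∈ discardedBy α n m T δ tie s r t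
            · simp [h, h1, him, hiD, hid]
            · simp [h, h1, him, hiD, hid, pullCount_self, winCount_self, Nat.lt_of_not_le him]
      · have h1 : ¬ t < τ := by omega
        have h1' : ¬ (t + 1) < τ := by omega
        by_cases hiD : i ∈ D <;> simp [h1, h1', h.ne', hiD]

lemma mem_held_pullMemory (hL : 0 < elimPulls α n T) (hm : m + 1 ≤ n)
    (htie : ∀ (t : ℕ) (S : Finset (Fin n)), S.Nonempty → tie t S ∈ S)
    (s : PairSample n m) (r : ℕ → Fin n → Bool) (t : ℕ) (i : Fin n) :
    i ∈ ((elimUCB α n m T δ tie).pullMemory s r t).held ↔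
      (i : ℕ) < (if t < elimPulls α n T * (2 * (n - m)) then m else n) ∧
        i ∉ discardedBy α n m T δ tie s r t := by
  simp only [Memory.held, Finset.mem_filter, Finset.mem_univ, true_and,
    (pullMemory_eq hL hm htie s r t).2 i]
  split_ifs <;> simp_all

/-- From the start of the UCB phase on, exactly the discarded arms are missing. -/
lemma mem_held_pullMemory_ucb (hL : 0 < elimPulls α n T) (hm : m + 1 ≤ n)
    (htie : ∀ (t : ℕ) (S : Finset (Fin n)), S.Nonempty → tie t S ∈ S)
    (s : PairSample n m) (r : ℕ → Fin n → Bool) {t : ℕ}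
    (ht : elimPulls α n T * (2 * (n - m)) ≤ t) (i : Fin n) :
    i ∈ ((elimUCB α n m T δ tie).pullMemory s r t).held ↔
      ∀ j, elimLoser α n m T δ tie s r j ≠ i := by
  rw [mem_held_pullMemory hL hm htie, if_neg (not_lt.2 ht), discardedBy_eq_image s r ht]
  simp

lemma card_held_pullMemory_le (hL : 0 < elimPulls α n T) (hm : m + 1 ≤ n)
    (htie : ∀ (t : ℕ) (S : Finset (Fin n)), S.Nonempty → tie t S ∈ S)
    (s : PairSample n m) (r : ℕ → Fin n → Bool) (t : ℕ) :
    ((elimUCB α n m T δ tie).pullMemory s r t).held.card ≤ m := by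
  rcases Nat.lt_or_ge t (elimPulls α n T * (2 * (n - m))) with ht | ht
  · have hsub : ((elimUCB α n m T δ tie).pullMemory s r t).held ⊆
        Finset.univ.filter fun i : Fin n => (i : ℕ) < m := by
      intro i hi
      rw [mem_held_pullMemory hL hm htie, if_pos ht] at hi
      simpa using hi.1
    refine (Finset.card_le_card hsub).trans ?_
    rw [Fin.card_filter_val_lt]
    exact min_le_right _ _
  · have heq : ((elimUCB α n m T δ tie).pullMemory s r t).held =
        (Finset.univ.image (elimLoser α n m T δ tie s r))ᶜ := by
      ext i
      rw [mem_held_pullMemory_ucb hL hm htie s r ht]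
      simp
    rw [heq, Finset.card_compl, Finset.card_image_of_injective _ (elimLoser_injective htie s r)]
    simp only [Fintype.card_fin, Finset.card_univ]
    omega

/-- The arm chosen in the UCB phase maximizes the index among the stored arms. -/
lemma armAt_mem_argmaxSet (hL : 0 < elimPulls α n T) (hm : m + 1 ≤ n)
    (htie : ∀ (t : ℕ) (S : Finset (Fin n)), S.Nonempty → tie t S ∈ S)
    (s : PairSample n m) (r : ℕ → Fin n → Bool) {t : ℕ}
    (ht : elimPulls α n T * (2 * (n - m)) ≤ t) :
    (elimUCB α n m T δ tie).armAt s r t ∈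
      argmaxSet ((elimUCB α n m T δ tie).pullMemory s r t).held fun i =>
        ucbIndex δ (((elimUCB α n m T δ tie).pullMemory s r t).statOf i) := by
  have h : (elimUCB α n m T δ tie).armAt s r t =
      tie t (argmaxSet ((elimUCB α n m T δ tie).pullMemory s r t).held fun i =>
        ucbIndex δ (((elimUCB α n m T δ tie).pullMemory s r t).statOf i)) := by
    conv_lhs => unfold StreamingStrategy.armAt
    conv_lhs => simp only [elimUCB]
    rw [dif_neg (not_lt.2 ht)]
    rfl
  rw [h]
  refine htie _ _ (argmaxSet_nonempty ?_ _)
  -- the last arm of the stream is never sampled, hence never discarded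
  refine ⟨⟨n - 1, by omega⟩, ?_⟩
  rw [mem_held_pullMemory hL hm htie, if_neg (not_lt.2 ht)]
  refine ⟨by simp only; omega, fun hi => ?_⟩
  have := lt_of_mem_discardedBy htie hi
  simp only at this
  omega

lemma elimUCB_usesMemory (hL : 0 < elimPulls α n T) (hm : m + 1 ≤ n)
    (htie : ∀ (t : ℕ) (S : Finset (Fin n)), S.Nonempty → tie t S ∈ S) :
    (elimUCB α n m T δ tie).UsesMemory m T := by
  intro s r t _
  refine ⟨card_held_pullMemory_le hL hm htie s r t, ?_⟩
  rcases Nat.lt_or_ge t (elimPulls α n T * (2 * (n - m))) with ht | ht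
  · rw [mem_held_pullMemory hL hm htie, if_pos ht, armAt_of_lt s r ht]
    refine ⟨s.arm_lt _, fun hi => ?_⟩
    simp only [discardedBy, Finset.mem_image, Finset.mem_filter, Finset.mem_univ, true_and] at hi
    obtain ⟨j, hj, h⟩ := hi
    obtain ⟨k, hk, h'⟩ := elimLoser_eq_arm (α := α) (T := T) (δ := δ) htie s r j
    have hkt : k = ⟨t / elimPulls α n T, Nat.div_lt_of_lt_mul ht⟩ :=
      s.arm_injective (by rw [← h', h])
    have h1 : 2 * ((j : ℕ) + 1) ≤ t / elimPulls α n T := by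
      rw [Nat.le_div_iff_mul_le hL]
      calc _ = 2 * elimPulls α n T * (j + 1) := by ring
        _ ≤ t := hj
    rw [hkt] at hk
    simp only at hk
    omega
  · exact (mem_argmaxSet.1 (armAt_mem_argmaxSet hL hm htie s r ht)).1

lemma statOf_pullMemory_ucb (hL : 0 < elimPulls α n T) (hm : m + 1 ≤ n)
    (htie : ∀ (t : ℕ) (S : Finset (Fin n)), S.Nonempty → tie t S ∈ S)
    (s : PairSample n m) (r : ℕ → Fin n → Bool) {t : ℕ}
    (ht : elimPulls α n T * (2 * (n - m)) ≤ t) {i : Fin n}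
    (hi : i ∈ ((elimUCB α n m T δ tie).pullMemory s r t).held) :
    ((elimUCB α n m T δ tie).pullMemory s r t).statOf i =
      ⟨pullCount ((elimUCB α n m T δ tie).armAt s r) i (elimPulls α n T * (2 * (n - m))) t,
        winCount ((elimUCB α n m T δ tie).armAt s r) r i (elimPulls α n T * (2 * (n - m))) t⟩ := by
  rw [mem_held_pullMemory hL hm htie] at hi
  rw [Memory.statOf, (pullMemory_eq hL hm htie s r t).2 i, if_pos hi, if_neg (not_lt.2 ht)]
  rfl

/-- The `k`-th sampled arm is pulled exactly in the rounds of its block. -/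
lemma armAt_eq_arm_iff (s : PairSample n m) (r : ℕ → Fin n → Bool) {t : ℕ}
    (ht : t < elimPulls α n T * (2 * (n - m))) (k : Fin (2 * (n - m))) :
    (elimUCB α n m T δ tie).armAt s r t = s.arm k ↔ t / elimPulls α n T = k := by
  rw [armAt_of_lt s r ht, s.arm_injective.eq_iff, Fin.ext_iff]

lemma card_filter_div_eq {L k t : ℕ} (hL : 0 < L) (hk : L * (k + 1) ≤ t) :
    ((Finset.range t).filter fun u => u / L = k).card = L := by
  have : (Finset.range t).filter (fun u => u / L = k) = Finset.Ico (L * k) (L * k + L) := by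
    ext u
    simp only [Finset.mem_filter, Finset.mem_range, Finset.mem_Ico]
    rw [Nat.div_eq_iff hL]
    have : L * (k + 1) = L * k + L := by ring
    have : L * k = k * L := by ring
    omega
  rw [this]
  simp

lemma pullCount_arm (hL : 0 < elimPulls α n T) (s : PairSample n m) (r : ℕ → Fin n → Bool)
    (k : Fin (2 * (n - m))) {t : ℕ} (hkt : elimPulls α n T * (k + 1) ≤ t)
    (ht : t ≤ elimPulls α n T * (2 * (n - m))) :
    pullCount ((elimUCB α n m T δ tie).armAt s r) (s.arm k) 0 t = elimPulls α n T := by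
  unfold pullCount
  rw [← card_filter_div_eq hL hkt, ← Finset.range_eq_Ico]
  refine congrArg Finset.card (Finset.filter_congr fun u hu => ?_)
  exact armAt_eq_arm_iff s r (lt_of_lt_of_le (Finset.mem_range.1 hu) ht) k

/-- The arm discarded from a pair had at most as many successes as the other one. -/
lemma winCount_elimLoser_le (hL : 0 < elimPulls α n T) (hm : m + 1 ≤ n)
    (htie : ∀ (t : ℕ) (S : Finset (Fin n)), S.Nonempty → tie t S ∈ S)
    (s : PairSample n m) (r : ℕ → Fin n → Bool) (j : Fin (n - m)) {k k' : Fin (2 * (n - m))}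
    (hk : (k : ℕ) / 2 = j) (hk' : (k' : ℕ) / 2 = j)
    (h : elimLoser α n m T δ tie s r j = s.arm k) :
    winCount ((elimUCB α n m T δ tie).armAt s r) r (s.arm k) 0
        (2 * elimPulls α n T * (j + 1)) ≤
      winCount ((elimUCB α n m T δ tie).armAt s r) r (s.arm k') 0
        (2 * elimPulls α n T * (j + 1)) := by
  set L := elimPulls α n T with hLdef
  set A := elimUCB α n m T δ tie with hA
  set τ := 2 * L * ((j : ℕ) + 1) with hτ
  have hj : (j : ℕ) + 1 ≤ n - m := j.2
  have hτle : τ ≤ L * (2 * (n - m)) := by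
    calc τ = L * (2 * (j + 1)) := by rw [hτ]; ring
      _ ≤ _ := Nat.mul_le_mul_left _ (by omega)
  have hτ0 : 0 < τ := by positivity
  -- both arms are stored with the statistics of all their `L` pulls
  have hstat : ∀ q : Fin (2 * (n - m)), (q : ℕ) / 2 = j →
      (A.memoryAt s r τ).statOf (s.arm q) = ⟨L, winCount (A.armAt s r) r (s.arm q) 0 τ⟩ := by
    intro q hq
    obtain ⟨t, ht⟩ : ∃ t, τ = t + 1 := ⟨τ - 1, by omega⟩
    have htlt : t < L * (2 * (n - m)) := by omega
    have h1 := (pullMemory_eq (δ := δ) hL hm htie s r t).2 (s.arm q)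
    rw [if_pos htlt, if_pos htlt] at h1
    have h2 := A.memoryAt_succ_stat s r (Nat.zero_le t) h1
    rw [← ht, if_pos] at h2
    · rw [Memory.statOf, h2, pullCount_arm hL s r q _ hτle]
      · rfl
      · calc L * (q + 1) ≤ L * (2 * (j + 1)) := Nat.mul_le_mul_left _ (by omega)
          _ = τ := by rw [hτ]; ring
    · refine ⟨s.arm_lt q, fun hq' => ?_⟩
      simp only [discardedBy, Finset.mem_image, Finset.mem_filter, Finset.mem_univ, true_and]
        at hq'
      obtain ⟨i, hi, hi'⟩ := hq'
      obtain ⟨p, hp, hp'⟩ := elimLoser_eq_arm (α := α) (T := T) (δ := δ) htie s r i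
      have hpq : p = q := s.arm_injective (by rw [← hp', hi'])
      have hij : (i : ℕ) = j := by rw [← hp, ← hq, hpq]
      rw [hij] at hi
      have hi : τ ≤ t := hi
      omega
  have hmem := elimLoser_mem (α := α) (T := T) (δ := δ) htie s r j
  rw [h, mem_argmaxSet] at hmem
  have hk'mem : s.arm k' ∈ ({s.arm ⟨2 * j, by omega⟩, s.arm ⟨2 * j + 1, by omega⟩} :
      Finset (Fin n)) := by
    rw [Finset.mem_insert, Finset.mem_singleton, s.arm_injective.eq_iff, s.arm_injective.eq_iff,
      Fin.ext_iff, Fin.ext_iff]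
    simp only
    omega
  have hle := hmem.2 _ hk'mem
  have e1 := hstat k hk
  have e2 := hstat k' hk'
  simp only [hτ] at e1 e2
  simp only [← hLdef, ← hA, e1, e2, ArmStat.mean, neg_le_neg_iff] at hle
  have hLpos : (0 : ℝ) < L := by exact_mod_cast hL
  rw [div_le_div_iff_of_pos_right hLpos] at hle
  exact_mod_cast hle

end Elimination

/-! ### Deviation probabilities of the algorithm -/

section Deviation

variable {n : ℕ}

lemma sum_indicator_mul_centredReward (μ : Fin n → unitInterval) (a : ℕ → Fin n)
    (r : ℕ → Fin n → Bool) (i : Fin n) (s t : ℕ) :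
    ∑ u ∈ Finset.range t, (if s ≤ u ∧ a u = i then 1 else 0) * centredReward μ (r u) (a u) =
      (winCount a r i s t : ℝ) - pullCount a i s t * (μ i : ℝ) := by
  have hIco : Finset.Ico s t = (Finset.range t).filter fun u => s ≤ u := by
    ext u; simp [and_comm]
  have h1 : (winCount a r i s t : ℝ) =
      ∑ u ∈ Finset.range t, if s ≤ u ∧ a u = i ∧ r u i = true then 1 else 0 := by
    rw [winCount, hIco, Finset.filter_filter, ← Finset.natCast_card_filter]
  have h2 : (pullCount a i s t : ℝ) =
      ∑ u ∈ Finset.range t, if s ≤ u ∧ a u = i then 1 else 0 := by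
    rw [pullCount, hIco, Finset.filter_filter, ← Finset.natCast_card_filter]
  rw [h1, h2, Finset.sum_mul, ← Finset.sum_sub_distrib]
  refine Finset.sum_congr rfl fun u _ => ?_
  by_cases hs : s ≤ u <;> by_cases ha : a u = i <;> simp [hs, ha, centredReward]

lemma sum_indicator_eq_pullCount (a : ℕ → Fin n) (i : Fin n) (s t : ℕ) :
    ∑ u ∈ Finset.range t, (if s ≤ u ∧ a u = i then 1 else 0 : ℝ) = pullCount a i s t := by
  have hIco : Finset.Ico s t = (Finset.range t).filter fun u => s ≤ u := by
    ext u; simp [and_comm]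
  rw [pullCount, hIco, Finset.filter_filter, ← Finset.natCast_card_filter]

variable {Seed : Type}

/-- The deviation of the empirical mean of an arm is controlled at each time and for each value of
its pull count. -/
lemma measureReal_deviation_le (μ : Fin n → unitInterval) (A : StreamingStrategy n Seed) (s : Seed)
    (i : Fin n) (τ t : ℕ) {N : ℕ} (hN : 0 < N) {B : ℝ} (hB : 0 ≤ B) :
    (rewardLaw μ).real {r | pullCount (A.armAt s r) i τ t = N ∧
      N * √(B / N) ≤ |(winCount (A.armAt s r) r i τ t : ℝ) - N * (μ i : ℝ)|} ≤
      2 * Real.exp (-(2 * B)) := by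
  have hN' : (0 : ℝ) < N := by exact_mod_cast hN
  have hx : 0 ≤ N * √(B / N) := by positivity
  have hexp : 2 * (N * √(B / N)) ^ 2 / N = 2 * B := by
    rw [mul_pow, Real.sq_sqrt (by positivity)]; field_simp
  have key : ∀ ε : ℝ, (rewardLaw μ).real {r | N * √(B / N) ≤
      ∑ u ∈ Finset.range t, (ε * if τ ≤ u ∧ A.armAt s r u = i then 1 else 0) *
        centredReward μ (r u) (A.armAt s r u) ∧
      ∑ u ∈ Finset.range t, (ε * if τ ≤ u ∧ A.armAt s r u = i then 1 else 0) ^ 2 ≤ (N : ℝ)} ≤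
      Real.exp (-(2 * B)) := by
    intro ε
    rw [← hexp]
    refine measureReal_weighted_sum_ge_le μ (A.dependsOn_armAt s)
      (w := fun u r => ε * if τ ≤ u ∧ A.armAt s r u = i then 1 else 0) (fun u => ?_) t hx hN'
    intro x y hxy
    have := A.dependsOn_armAt s u hxy
    simp only at this
    simp only [this]
  have hsub : {r | pullCount (A.armAt s r) i τ t = N ∧
      N * √(B / N) ≤ |(winCount (A.armAt s r) r i τ t : ℝ) - N * (μ i : ℝ)|} ⊆
      {r | N * √(B / N) ≤
      ∑ u ∈ Finset.range t, ((1 : ℝ) * if τ ≤ u ∧ A.armAt s r u = i then 1 else 0) *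
        centredReward μ (r u) (A.armAt s r u) ∧
      ∑ u ∈ Finset.range t, ((1 : ℝ) * if τ ≤ u ∧ A.armAt s r u = i then 1 else 0) ^ 2 ≤ (N : ℝ)} ∪
      {r | N * √(B / N) ≤
      ∑ u ∈ Finset.range t, ((-1 : ℝ) * if τ ≤ u ∧ A.armAt s r u = i then 1 else 0) *
        centredReward μ (r u) (A.armAt s r u) ∧
      ∑ u ∈ Finset.range t,
        ((-1 : ℝ) * if τ ≤ u ∧ A.armAt s r u = i then 1 else 0) ^ 2 ≤ (N : ℝ)} := by
    rintro r ⟨h1, h2⟩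
    have hsq : ∀ ε : ℝ, ε ^ 2 = 1 → ∑ u ∈ Finset.range t,
        (ε * if τ ≤ u ∧ A.armAt s r u = i then 1 else 0) ^ 2 = (N : ℝ) := by
      intro ε hε
      rw [← h1, ← sum_indicator_eq_pullCount]
      refine Finset.sum_congr rfl fun u _ => ?_
      rw [mul_pow, hε]
      split_ifs <;> simp
    have hsum : ∀ ε : ℝ, ∑ u ∈ Finset.range t,
        (ε * if τ ≤ u ∧ A.armAt s r u = i then 1 else 0) *
          centredReward μ (r u) (A.armAt s r u) =
        ε * ((winCount (A.armAt s r) r i τ t : ℝ) - N * (μ i : ℝ)) := by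
      intro ε
      rw [← h1, ← sum_indicator_mul_centredReward μ, Finset.mul_sum]
      exact Finset.sum_congr rfl fun u _ => by ring
    rcases le_abs.1 h2 with h | h
    · left
      exact ⟨by rw [hsum, one_mul]; exact h, (hsq 1 (by norm_num)).le⟩
    · right
      exact ⟨by rw [hsum, neg_one_mul]; exact h, (hsq (-1) (by norm_num)).le⟩
  calc _ ≤ _ := measureReal_mono hsub
    _ ≤ _ := measureReal_union_le _ _
    _ ≤ Real.exp (-(2 * B)) + Real.exp (-(2 * B)) :=
      add_le_add (key 1) (key (-1))
    _ = _ := by ring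

/-- In all rounds before `T`, the empirical means of all arms that were pulled since round `τ` are
within their confidence radius `√(B / N)`, where `N` is the number of pulls since round `τ`. -/
def ConfidenceHolds (μ : Fin n → unitInterval) (a : ℕ → Fin n) (r : ℕ → Fin n → Bool) (B : ℝ)
    (τ T : ℕ) : Prop :=
  ∀ i, ∀ t < T, 0 < pullCount a i τ t →
    |(winCount a r i τ t : ℝ) / pullCount a i τ t - (μ i : ℝ)| ≤ √(B / pullCount a i τ t)

lemma pullCount_le (a : ℕ → Fin n) (i : Fin n) (s t : ℕ) : pullCount a i s t ≤ t := by
  refine (Finset.card_filter_le _ _).trans ?_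
  simp

lemma measureReal_not_confidenceHolds_le (μ : Fin n → unitInterval) (A : StreamingStrategy n Seed)
    (s : Seed) (τ T : ℕ) {B : ℝ} (hB : 0 ≤ B) :
    (rewardLaw μ).real {r | ¬ ConfidenceHolds μ (A.armAt s r) r B τ T} ≤
      2 * n * T ^ 2 * Real.exp (-(2 * B)) := by
  have hsub : {r | ¬ ConfidenceHolds μ (A.armAt s r) r B τ T} ⊆
      ⋃ z ∈ (Finset.univ : Finset (Fin n)) ×ˢ Finset.range T ×ˢ Finset.Icc 1 T,
        {r | pullCount (A.armAt s r) z.1 τ z.2.1 = z.2.2 ∧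
          z.2.2 * √(B / z.2.2) ≤
            |(winCount (A.armAt s r) r z.1 τ z.2.1 : ℝ) - z.2.2 * (μ z.1 : ℝ)|} := by
    intro r hr
    rw [Set.mem_ofPred_eq, ConfidenceHolds] at hr
    push Not at hr
    obtain ⟨i, t, ht, hpos, h⟩ := hr
    have hpos' : (0 : ℝ) < pullCount (A.armAt s r) i τ t := by exact_mod_cast hpos
    refine Set.mem_biUnion (x := (i, t, pullCount (A.armAt s r) i τ t)) ?_ ⟨rfl, ?_⟩
    · simp only [Finset.coe_product, Set.mem_prod, Finset.mem_coe, Finset.mem_univ,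
        Finset.mem_range, Finset.mem_Icc, true_and]
      exact ⟨ht, hpos, (pullCount_le _ _ _ _).trans ht.le⟩
    · simp only
      calc _ ≤ (pullCount (A.armAt s r) i τ t : ℝ) *
            |(winCount (A.armAt s r) r i τ t : ℝ) / pullCount (A.armAt s r) i τ t - (μ i : ℝ)| := by
            gcongr
        _ = _ := by
            rw [← abs_of_pos hpos', ← abs_mul, abs_of_pos hpos']
            congr 1
            field_simp
  refine (measureReal_mono hsub (measure_ne_top _ _)).trans ((measureReal_biUnion_finset_le _ _).trans ?_)
  calc _ ≤ ∑ z ∈ (Finset.univ : Finset (Fin n)) ×ˢ Finset.range T ×ˢ Finset.Icc 1 T,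
        2 * Real.exp (-(2 * B)) := by
        refine Finset.sum_le_sum fun z hz => ?_
        simp only [Finset.mem_product, Finset.mem_Icc] at hz
        exact measureReal_deviation_le μ A s z.1 τ z.2.1 hz.2.2.1 hB
    _ = _ := by
        simp only [Finset.sum_const, Finset.card_product, Finset.card_univ, Fintype.card_fin,
          Finset.card_range, Nat.card_Icc, nsmul_eq_mul]
        push_cast
        ring

end Deviation

section Elimination

variable {α : ℝ} {n m T : ℕ} {δ : ℝ} {tie : ℕ → Finset (Fin n) → Fin n}

/-- The better arm of a pair loses with exponentially small probability. -/
lemma measureReal_elimLoser_eq_le (hL : 0 < elimPulls α n T) (hm : m + 1 ≤ n)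
    (htie : ∀ (t : ℕ) (S : Finset (Fin n)), S.Nonempty → tie t S ∈ S)
    (μ : Fin n → unitInterval) (s : PairSample n m) (j : Fin (n - m)) {k k' : Fin (2 * (n - m))}
    (hk : (k : ℕ) / 2 = j) (hk' : (k' : ℕ) / 2 = j) (hkk' : k ≠ k')
    (hle : (μ (s.arm k') : ℝ) ≤ μ (s.arm k)) :
    (rewardLaw μ).real {r | elimLoser α n m T δ tie s r j = s.arm k} ≤
      Real.exp (-(elimPulls α n T * ((μ (s.arm k) : ℝ) - μ (s.arm k')) ^ 2)) := by
  set L := elimPulls α n T with hLdef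
  set A := elimUCB α n m T δ tie with hA
  set τ := 2 * L * ((j : ℕ) + 1) with hτ
  set Δ := (μ (s.arm k) : ℝ) - μ (s.arm k') with hΔ
  have hLpos : (0 : ℝ) < L := by exact_mod_cast hL
  have hj : (j : ℕ) + 1 ≤ n - m := j.2
  have hτle : τ ≤ L * (2 * (n - m)) := by
    calc τ = L * (2 * (j + 1)) := by rw [hτ]; ring
      _ ≤ _ := Nat.mul_le_mul_left _ (by omega)
  have hcount : ∀ (r : ℕ → Fin n → Bool) (q : Fin (2 * (n - m))), (q : ℕ) / 2 = j →
      pullCount (A.armAt s r) (s.arm q) 0 τ = L := by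
    intro r q hq
    refine pullCount_arm hL s r q ?_ hτle
    calc L * (q + 1) ≤ L * (2 * (j + 1)) := Nat.mul_le_mul_left _ (by omega)
      _ = τ := by rw [hτ]; ring
  have hne : s.arm k ≠ s.arm k' := fun h => hkk' (s.arm_injective h)
  set w : ℕ → (ℕ → Fin n → Bool) → ℝ := fun u r =>
    (if 0 ≤ u ∧ A.armAt s r u = s.arm k' then 1 else 0) -
      (if 0 ≤ u ∧ A.armAt s r u = s.arm k then 1 else 0) with hw
  have hbound := measureReal_weighted_sum_ge_le μ (A.dependsOn_armAt s) (w := w)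
    (fun u x y hxy => by
      have := A.dependsOn_armAt s u hxy
      simp only at this
      simp only [hw, this]) τ (x := L * Δ) (v := 2 * L)
    (mul_nonneg hLpos.le (by linarith)) (by positivity)
  have hexp : 2 * (L * Δ) ^ 2 / (2 * L) = L * Δ ^ 2 := by field_simp
  rw [hexp] at hbound
  refine (measureReal_mono ?_).trans hbound
  intro r hr
  have hwin := winCount_elimLoser_le hL hm htie s r j hk hk' hr
  have hwin' : (winCount (A.armAt s r) r (s.arm k) 0 τ : ℝ) ≤
      winCount (A.armAt s r) r (s.arm k') 0 τ := by exact_mod_cast hwin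
  constructor
  · simp only [hw, sub_mul, Finset.sum_sub_distrib, sum_indicator_mul_centredReward]
    rw [hcount r k hk, hcount r k' hk']
    rw [hΔ]
    linarith
  · have : ∀ u, w u r ^ 2 = (if 0 ≤ u ∧ A.armAt s r u = s.arm k' then 1 else 0) +
        (if 0 ≤ u ∧ A.armAt s r u = s.arm k then 1 else 0) := by
      intro u
      by_cases h1 : A.armAt s r u = s.arm k
      · simp [hw, h1, hne]
      · by_cases h2 : A.armAt s r u = s.arm k' <;> simp [hw, h1, h2, hne.symm]
    simp only [this, Finset.sum_add_distrib, sum_indicator_eq_pullCount]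
    rw [hcount r k hk, hcount r k' hk']
    linarith

end Elimination

/-! ### Regret along a run -/

section Gap

variable {n : ℕ} (μ : Fin n → unitInterval)

lemma gap_nonneg (i : Fin n) : 0 ≤ gap μ i :=
  sub_nonneg.2 (le_ciSup (f := fun i => (μ i : ℝ)) (Set.finite_range _).bddAbove i)

lemma exists_gap_eq_zero (hn : 0 < n) : ∃ i, gap μ i = 0 := by
  have : Nonempty (Fin n) := ⟨⟨0, hn⟩⟩
  obtain ⟨i, hi⟩ := exists_eq_ciSup_of_finite (f := fun i => (μ i : ℝ))
  exact ⟨i, sub_eq_zero.2 hi.symm⟩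

lemma gap_le_one (i : Fin n) : gap μ i ≤ 1 := by
  have : Nonempty (Fin n) := ⟨i⟩
  have h1 : bestMean μ ≤ 1 := ciSup_le fun i => (μ i).2.2
  have h2 : (0 : ℝ) ≤ μ i := (μ i).2.1
  unfold gap
  linarith

/-- The sum of the inverse gaps of the suboptimal arms. -/
noncomputable def invGapSum : ℝ := ∑ i, if 0 < gap μ i then (gap μ i)⁻¹ else 0

lemma invGapSum_nonneg : 0 ≤ invGapSum μ :=
  Finset.sum_nonneg fun i _ => by
    split_ifs with h
    · exact inv_nonneg.2 h.le
    · exact le_rfl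

lemma sum_pullCount_le (a : ℕ → Fin n) (τ T : ℕ) : ∑ i, pullCount a i τ T ≤ T := by
  unfold pullCount
  rw [← Finset.card_eq_sum_card_fiberwise (fun _ _ => Finset.mem_coe.2 (Finset.mem_univ _))]
  simp

lemma sum_gap_Ico (a : ℕ → Fin n) (τ T : ℕ) :
    ∑ t ∈ Finset.Ico τ T, gap μ (a t) = ∑ i, gap μ i * pullCount a i τ T := by
  rw [← Finset.sum_fiberwise (Finset.Ico τ T) a]
  refine Finset.sum_congr rfl fun i _ => ?_
  rw [Finset.sum_congr rfl (g := fun _ => gap μ i)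
    fun t ht => by rw [(Finset.mem_filter.1 ht).2]]
  rw [Finset.sum_const, nsmul_eq_mul, mul_comm, pullCount]

/-- An arm that is only pulled while it has at most `X` pulls ends up with at most `X + 1`. -/
lemma pullCount_le_of_forall (a : ℕ → Fin n) (i : Fin n) (τ T : ℕ) {X : ℝ} (hX : 0 ≤ X)
    (h : ∀ t, τ ≤ t → t < T → a t = i → (pullCount a i τ t : ℝ) ≤ X) :
    (pullCount a i τ T : ℝ) ≤ X + 1 := by
  induction T with
  | zero => simp only [pullCount, Finset.Ico_eq_empty_of_le (Nat.zero_le τ)]; simp; linarith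
  | succ T ih =>
    rcases Nat.lt_or_ge T τ with hT | hT
    · simp only [pullCount, Finset.Ico_eq_empty_of_le (show T + 1 ≤ τ from hT)]; simp; linarith
    · rw [pullCount_succ a i hT]
      split_ifs with hi
      · have := h T hT (Nat.lt_succ_self T) hi
        push_cast
        linarith
      · exact ih fun t h1 h2 => h t h1 (by omega)

end Gap

section Elimination

variable {α : ℝ} {n m T : ℕ} {δ : ℝ} {tie : ℕ → Finset (Fin n) → Fin n}

/-- While confidence holds, an arm with a gap more than twice that of some stored arm `b` is
pulled rarely: its gap to `b` is more than half of its gap. -/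
lemma pullCount_le_of_confidenceHolds (hL : 0 < elimPulls α n T) (hm : m + 1 ≤ n)
    (htie : ∀ (t : ℕ) (S : Finset (Fin n)), S.Nonempty → tie t S ∈ S)
    (μ : Fin n → unitInterval) (s : PairSample n m) (r : ℕ → Fin n → Bool)
    (hB : 0 ≤ 2 * Real.log (1 / δ))
    (hconf : ConfidenceHolds μ ((elimUCB α n m T δ tie).armAt s r) r (2 * Real.log (1 / δ))
      (elimPulls α n T * (2 * (n - m))) T)
    {b : Fin n} (hb : ∀ j, elimLoser α n m T δ tie s r j ≠ b) {i : Fin n}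
    (hi : 2 * gap μ b < gap μ i) :
    (pullCount ((elimUCB α n m T δ tie).armAt s r) i (elimPulls α n T * (2 * (n - m))) T : ℝ) ≤
      16 * (2 * Real.log (1 / δ)) / gap μ i ^ 2 + 1 := by
  set B := 2 * Real.log (1 / δ) with hBdef
  set τ := elimPulls α n T * (2 * (n - m)) with hτ
  set A := elimUCB α n m T δ tie with hA
  have hgb := gap_nonneg μ b
  have hgi : 0 < gap μ i := by linarith
  refine pullCount_le_of_forall _ i τ T (by positivity) fun t hτt htT hti => ?_
  rcases Nat.eq_zero_or_pos (pullCount (A.armAt s r) i τ t) with h0 | hpos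
  · rw [h0]; simp only [Nat.cast_zero]; positivity
  have hbheld := (mem_held_pullMemory_ucb (δ := δ) hL hm htie s r hτt b).2 hb
  have harg := mem_argmaxSet.1 (armAt_mem_argmaxSet (δ := δ) hL hm htie s r hτt)
  have hiheld := harg.1
  have hle := harg.2 b hbheld
  rw [statOf_pullMemory_ucb hL hm htie s r hτt hbheld,
    statOf_pullMemory_ucb hL hm htie s r hτt hiheld] at hle
  rw [← hA, hti] at hle
  simp only [ucbIndex, if_neg hpos.ne', ← hτ] at hle
  rcases Nat.eq_zero_or_pos (pullCount (A.armAt s r) b τ t) with hb0 | hbpos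
  · rw [if_pos hb0] at hle
    exact absurd (top_le_iff.1 hle) (EReal.coe_ne_top _)
  rw [if_neg hbpos.ne', EReal.coe_le_coe_iff] at hle
  simp only [ArmStat.mean, ← hBdef] at hle
  have hci := abs_le.1 (hconf i t htT hpos)
  have hcb := abs_le.1 (hconf b t htT hbpos)
  have hN : (0 : ℝ) < pullCount (A.armAt s r) i τ t := by exact_mod_cast hpos
  set N : ℝ := ((pullCount (A.armAt s r) i τ t : ℕ) : ℝ) with hNdef
  have hgap : gap μ i - gap μ b = μ b - μ i := by unfold gap; ring
  have h4 : gap μ i ≤ 4 * √(B / N) := by linarith [hci.1, hci.2, hcb.1, hcb.2]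
  have h5 : gap μ i ^ 2 ≤ 16 * (B / N) := by
    calc gap μ i ^ 2 ≤ (4 * √(B / N)) ^ 2 := by gcongr
      _ = 16 * (B / N) := by rw [mul_pow, Real.sq_sqrt (by positivity)]; norm_num
  rw [le_div_iff₀ (by positivity)]
  calc N * gap μ i ^ 2 ≤ N * (16 * (B / N)) := by gcongr
    _ = 16 * B := by field_simp

/-- The regret of the UCB phase while confidence holds, in terms of the gap of a stored arm. -/
lemma sum_gap_ucb_le (hL : 0 < elimPulls α n T) (hm : m + 1 ≤ n)
    (htie : ∀ (t : ℕ) (S : Finset (Fin n)), S.Nonempty → tie t S ∈ S)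
    (μ : Fin n → unitInterval) (s : PairSample n m) (r : ℕ → Fin n → Bool)
    (hB : 0 ≤ 2 * Real.log (1 / δ))
    (hconf : ConfidenceHolds μ ((elimUCB α n m T δ tie).armAt s r) r (2 * Real.log (1 / δ))
      (elimPulls α n T * (2 * (n - m))) T)
    {b : Fin n} (hb : ∀ j, elimLoser α n m T δ tie s r j ≠ b) :
    ∑ t ∈ Finset.Ico (elimPulls α n T * (2 * (n - m))) T,
        gap μ ((elimUCB α n m T δ tie).armAt s r t) ≤
      2 * T * gap μ b + (16 * (2 * Real.log (1 / δ)) + 1) * invGapSum μ := by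
  rw [sum_gap_Ico]
  set B := 2 * Real.log (1 / δ) with hBdef
  set τ := elimPulls α n T * (2 * (n - m)) with hτ
  set A := elimUCB α n m T δ tie with hA
  have hgb := gap_nonneg μ b
  have hterm : ∀ i, gap μ i * pullCount (A.armAt s r) i τ T ≤
      2 * gap μ b * pullCount (A.armAt s r) i τ T +
        (16 * B + 1) * (if 0 < gap μ i then (gap μ i)⁻¹ else 0) := by
    intro i
    rcases le_or_gt (gap μ i) (2 * gap μ b) with h | h
    · have h1 : 0 ≤ (16 * B + 1) * (if 0 < gap μ i then (gap μ i)⁻¹ else 0) := by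
        have := gap_nonneg μ i
        positivity
      have h2 : gap μ i * pullCount (A.armAt s r) i τ T ≤
          2 * gap μ b * pullCount (A.armAt s r) i τ T := by gcongr
      linarith
    · have hpos : 0 < gap μ i := by linarith
      have h1 := pullCount_le_of_confidenceHolds hL hm htie μ s r hB hconf hb h
      rw [if_pos hpos]
      have h2 : gap μ i ≤ (gap μ i)⁻¹ :=
        (gap_le_one μ i).trans ((one_le_inv₀ hpos).2 (gap_le_one μ i))
      calc gap μ i * pullCount (A.armAt s r) i τ T
          ≤ gap μ i * (16 * B / gap μ i ^ 2 + 1) := by gcongr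
        _ = 16 * B * (gap μ i)⁻¹ + gap μ i := by field_simp
        _ ≤ 16 * B * (gap μ i)⁻¹ + (gap μ i)⁻¹ := by gcongr
        _ = (16 * B + 1) * (gap μ i)⁻¹ := by ring
        _ ≤ _ := le_add_of_nonneg_left (by positivity)
  calc _ ≤ ∑ i, (2 * gap μ b * pullCount (A.armAt s r) i τ T +
        (16 * B + 1) * (if 0 < gap μ i then (gap μ i)⁻¹ else 0)) :=
        Finset.sum_le_sum fun i _ => hterm i
    _ = 2 * gap μ b * ((∑ i, pullCount (A.armAt s r) i τ T : ℕ) : ℝ) +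
        (16 * B + 1) * invGapSum μ := by
        rw [Finset.sum_add_distrib, ← Finset.mul_sum, ← Finset.mul_sum, invGapSum]
        push_cast
        rfl
    _ ≤ 2 * gap μ b * T + (16 * B + 1) * invGapSum μ := by
        gcongr
        exact_mod_cast sum_pullCount_le _ _ _
    _ = _ := by ring

/-- The regret of the elimination phase: each sampled arm is pulled `elimPulls α n T` times. -/
lemma sum_gap_elim_eq (hL : 0 < elimPulls α n T) (μ : Fin n → unitInterval) (s : PairSample n m)
    (r : ℕ → Fin n → Bool) :
    ∑ t ∈ Finset.range (elimPulls α n T * (2 * (n - m))),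
        gap μ ((elimUCB α n m T δ tie).armAt s r t) =
      elimPulls α n T * ∑ k, gap μ (s.arm k) := by
  set τ := elimPulls α n T * (2 * (n - m)) with hτ
  set A := elimUCB α n m T δ tie with hA
  rw [Finset.range_eq_Ico, sum_gap_Ico]
  have hzero : ∀ i ∉ Finset.univ.image s.arm, pullCount (A.armAt s r) i 0 τ = 0 := by
    intro i hi
    rw [pullCount, Finset.card_eq_zero]
    refine Finset.filter_false_of_mem fun t ht hti => hi ?_
    rw [armAt_of_lt s r (Finset.mem_Ico.1 ht).2] at hti
    exact Finset.mem_image.2 ⟨_, Finset.mem_univ _, hti⟩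
  rw [← Finset.sum_subset (Finset.subset_univ (Finset.univ.image s.arm))
    (fun i _ hi => by rw [hzero i hi]; simp), Finset.sum_image s.arm_injective.injOn,
    Finset.mul_sum]
  refine Finset.sum_congr rfl fun k _ => ?_
  rw [pullCount_arm hL s r k (Nat.mul_le_mul_left _ k.2) le_rfl, mul_comm]

/-- The other member of the pair of the `k`-th sampled arm. -/
def pairPartner {c : ℕ} (k : Fin (2 * c)) : Fin (2 * c) :=
  ⟨if (k : ℕ) % 2 = 0 then k + 1 else k - 1, by split_ifs <;> omega⟩

lemma pairPartner_div_two {c : ℕ} (k : Fin (2 * c)) : (pairPartner k : ℕ) / 2 = (k : ℕ) / 2 := by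
  simp only [pairPartner]
  split_ifs <;> omega

lemma pairPartner_ne {c : ℕ} (k : Fin (2 * c)) : k ≠ pairPartner k := by
  rw [Ne, Fin.ext_iff]
  simp only [pairPartner]
  split_ifs <;> omega

lemma elimLoser_ne_pairPartner
    (htie : ∀ (t : ℕ) (S : Finset (Fin n)), S.Nonempty → tie t S ∈ S)
    (s : PairSample n m) (r : ℕ → Fin n → Bool) {j : Fin (n - m)} {k : Fin (2 * (n - m))}
    (hk : (k : ℕ) / 2 = j) (h : elimLoser α n m T δ tie s r j = s.arm k) (j' : Fin (n - m)) :
    elimLoser α n m T δ tie s r j' ≠ s.arm (pairPartner k) := by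
  intro h'
  obtain ⟨q, hq, hq'⟩ := elimLoser_eq_arm (α := α) (T := T) (δ := δ) htie s r j'
  have hqk : q = pairPartner k := s.arm_injective (by rw [← hq', h'])
  have hjj : j' = j := by
    apply Fin.ext
    rw [← hq, hqk, pairPartner_div_two, hk]
  rw [hjj, h] at h'
  exact pairPartner_ne k (s.arm_injective h')

/-- The pair of the `k`-th sampled arm. -/
def pairIndex {c : ℕ} (k : Fin (2 * c)) : Fin c := ⟨(k : ℕ) / 2, by omega⟩

open Classical in
/-- The regret of a run. If the optimal arm `i` is discarded, then the partner that beat it stays in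
memory and replaces it as the benchmark of the UCB phase. -/
lemma regret_le (hL : 0 < elimPulls α n T) (hm : m + 1 ≤ n)
    (htie : ∀ (t : ℕ) (S : Finset (Fin n)), S.Nonempty → tie t S ∈ S)
    (μ : Fin n → unitInterval) (s : PairSample n m) (r : ℕ → Fin n → Bool)
    (hB : 0 ≤ 2 * Real.log (1 / δ)) {i : Fin n} (hi : gap μ i = 0) :
    (elimUCB α n m T δ tie).regret μ T (s, r) ≤
      elimPulls α n T * ∑ k, gap μ (s.arm k) +
      2 * T * (∑ k, if s.arm k = i ∧ elimLoser α n m T δ tie s r (pairIndex k) = s.arm k then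
        gap μ (s.arm (pairPartner k)) else 0) +
      (16 * (2 * Real.log (1 / δ)) + 1) * invGapSum μ +
      (if ConfidenceHolds μ ((elimUCB α n m T δ tie).armAt s r) r (2 * Real.log (1 / δ))
        (elimPulls α n T * (2 * (n - m))) T then 0 else (T : ℝ)) := by
  rw [← sum_gap_elim_eq (δ := δ) (tie := tie) hL μ s r]
  set B := 2 * Real.log (1 / δ) with hBdef
  set τ := elimPulls α n T * (2 * (n - m)) with hτ
  set A := elimUCB α n m T δ tie with hA
  set P := ∑ k, if s.arm k = i ∧ elimLoser α n m T δ tie s r (pairIndex k) = s.arm k then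
    gap μ (s.arm (pairPartner k)) else 0 with hP
  have hPterm : ∀ k, 0 ≤ if s.arm k = i ∧ elimLoser α n m T δ tie s r (pairIndex k) = s.arm k then
      gap μ (s.arm (pairPartner k)) else 0 := fun k => by
    split_ifs
    · exact gap_nonneg μ _
    · exact le_rfl
  have hP0 : 0 ≤ P := Finset.sum_nonneg fun k _ => hPterm k
  have hS0 := invGapSum_nonneg μ
  have hsplit : A.regret μ T (s, r) ≤ ∑ t ∈ Finset.range τ, gap μ (A.armAt s r t) +
      ∑ t ∈ Finset.Ico τ T, gap μ (A.armAt s r t) := by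
    change ∑ t ∈ Finset.range T, gap μ (A.armAt s r t) ≤ _
    rcases le_total τ T with h | h
    · exact (Finset.sum_range_add_sum_Ico _ h).ge
    · rw [Finset.Ico_eq_empty_of_le h, Finset.sum_empty, add_zero]
      exact Finset.sum_le_sum_of_subset_of_nonneg (Finset.range_subset_range.2 h)
        fun t _ _ => gap_nonneg μ _
  split_ifs with hconf
  · suffices h : ∃ b, (∀ j, elimLoser α n m T δ tie s r j ≠ b) ∧ gap μ b ≤ P by
      obtain ⟨b, hb, hbP⟩ := h
      have h1 := sum_gap_ucb_le hL hm htie μ s r hB hconf hb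
      have h2 : 2 * (T : ℝ) * gap μ b ≤ 2 * T * P := by gcongr
      linarith
    by_cases hlost : ∃ j, elimLoser α n m T δ tie s r j = i
    · obtain ⟨j, hj⟩ := hlost
      obtain ⟨k, hk, hk'⟩ := elimLoser_eq_arm (α := α) (T := T) (δ := δ) htie s r j
      refine ⟨s.arm (pairPartner k), elimLoser_ne_pairPartner htie s r hk hk', ?_⟩
      have hjk : pairIndex k = j := Fin.ext hk
      have := Finset.single_le_sum (fun k _ => hPterm k) (Finset.mem_univ k)
      rw [if_pos ⟨by rw [← hk', hj], by rw [hjk, hk']⟩] at this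
      exact this
    · push Not at hlost
      exact ⟨i, hlost, by rw [hi]; exact hP0⟩
  · have h1 : ∑ t ∈ Finset.Ico τ T, gap μ (A.armAt s r t) ≤ T := by
      calc _ ≤ ∑ t ∈ Finset.Ico τ T, (1 : ℝ) := Finset.sum_le_sum fun t _ => gap_le_one μ _
        _ = ((T - τ : ℕ) : ℝ) := by simp
        _ ≤ T := by exact_mod_cast Nat.sub_le _ _
    have h2 : 0 ≤ 2 * (T : ℝ) * P := by positivity
    have h3 : 0 ≤ (16 * B + 1) * invGapSum μ := by positivity
    linarith

end Elimination

/-! ### Expected regret for a given sample -/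

section Elimination

variable {α : ℝ} {n m T : ℕ} {δ : ℝ} {tie : ℕ → Finset (Fin n) → Fin n}

lemma integral_ite_rewardTable (μ : Fin n → unitInterval) {t : ℕ}
    {E : (ℕ → Fin n → Bool) → Prop} [DecidablePred E] (hE : DependsOn E (Set.Iio t)) (c : ℝ) :
    ∫ r, (if E r then c else 0) ∂(rewardLaw μ) = (rewardLaw μ).real {r | E r} * c := by
  classical
  have hmeas : MeasurableSet {r | E r} := measurableSet_setOfPred.2 hE.measurable_rewardTable
  have := integral_indicator_const (μ := rewardLaw μ) c hmeas
  rw [smul_eq_mul] at this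
  rw [← this]
  refine integral_congr_ae (.of_forall fun r => ?_)
  simp [Set.indicator]

lemma dependsOn_elimLoser (s : PairSample n m) (j : Fin (n - m)) :
    DependsOn (fun r => elimLoser α n m T δ tie s r j)
      (Set.Iio (2 * elimPulls α n T * (j + 1))) := by
  intro x y hxy
  have h := (elimUCB α n m T δ tie).dependsOn_memoryAt s _ hxy
  simp only at h
  simp only [elimLoser, h]

variable {Seed : Type}

lemma dependsOn_confidenceHolds (μ : Fin n → unitInterval) (A : StreamingStrategy n Seed) (s : Seed)
    (B : ℝ) (τ T : ℕ) :
    DependsOn (fun r => ConfidenceHolds μ (A.armAt s r) r B τ T) (Set.Iio T) := by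
  intro x y hxy
  have harm : ∀ u < T, A.armAt s x u = A.armAt s y u := fun u hu =>
    A.dependsOn_armAt s u fun v hv => hxy v (lt_trans hv hu)
  have hp : ∀ i, ∀ t < T, pullCount (A.armAt s x) i τ t = pullCount (A.armAt s y) i τ t := by
    intro i t ht
    refine congrArg Finset.card (Finset.filter_congr fun u hu => ?_)
    rw [harm u ((Finset.mem_Ico.1 hu).2.trans ht)]
  have hw : ∀ i, ∀ t < T, winCount (A.armAt s x) x i τ t = winCount (A.armAt s y) y i τ t := by
    intro i t ht
    refine congrArg Finset.card (Finset.filter_congr fun u hu => ?_)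
    have hu' := (Finset.mem_Ico.1 hu).2.trans ht
    rw [harm u hu', hxy u hu']
  refine propext (forall_congr' fun i => forall_congr' fun t => forall_congr' fun ht => ?_)
  rw [hp i t ht, hw i t ht]

lemma dependsOn_regret (μ : Fin n → unitInterval) (A : StreamingStrategy n Seed) (s : Seed)
    (T : ℕ) : DependsOn (fun r => A.regret μ T (s, r)) (Set.Iio T) := by
  intro x y hxy
  refine Finset.sum_congr rfl fun u hu => ?_
  have := A.dependsOn_armAt s u fun v hv => hxy v (lt_trans hv (Finset.mem_range.1 hu))
  simp only at this
  simp only [this]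

open Classical in
/-- The expected regret for a given sample. -/
lemma integral_regret_le (hL : 0 < elimPulls α n T) (hm : m + 1 ≤ n)
    (htie : ∀ (t : ℕ) (S : Finset (Fin n)), S.Nonempty → tie t S ∈ S)
    (μ : Fin n → unitInterval) (s : PairSample n m)
    (hB : 0 ≤ 2 * Real.log (1 / δ)) {i : Fin n} (hi : gap μ i = 0) :
    ∫ r, (elimUCB α n m T δ tie).regret μ T (s, r) ∂(rewardLaw μ) ≤
      elimPulls α n T * ∑ k, gap μ (s.arm k) +
      2 * T * (∑ k, if s.arm k = i then gap μ (s.arm (pairPartner k)) *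
        Real.exp (-(elimPulls α n T * gap μ (s.arm (pairPartner k)) ^ 2)) else 0) +
      (16 * (2 * Real.log (1 / δ)) + 1) * invGapSum μ +
      T * (2 * n * T ^ 2 * Real.exp (-(2 * (2 * Real.log (1 / δ))))) := by
  set B := 2 * Real.log (1 / δ) with hBdef
  set τ := elimPulls α n T * (2 * (n - m)) with hτ
  set A := elimUCB α n m T δ tie with hA
  set L := elimPulls α n T with hLdef
  have hdepE : ∀ k, DependsOn (fun r => s.arm k = i ∧
      elimLoser α n m T δ tie s r (pairIndex k) = s.arm k)
      (Set.Iio (2 * L * ((pairIndex k : ℕ) + 1))) := fun k x y hxy => by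
    have := dependsOn_elimLoser (α := α) (T := T) (δ := δ) (tie := tie) s (pairIndex k) hxy
    simp only at this
    simp only [this]
  have hdepC : DependsOn (fun r => ¬ ConfidenceHolds μ (A.armAt s r) r B τ T) (Set.Iio T) :=
    fun x y hxy => by
      have := dependsOn_confidenceHolds μ A s B τ T hxy
      simp only at this
      simp only [this]
  have hint1 : ∀ k, Integrable (fun r => if s.arm k = i ∧
      elimLoser α n m T δ tie s r (pairIndex k) = s.arm k then
        gap μ (s.arm (pairPartner k)) else 0) (rewardLaw μ) := fun k =>
    DependsOn.integrable_rewardTable (t := 2 * L * ((pairIndex k : ℕ) + 1)) fun x y hxy => by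
      have := hdepE k hxy
      simp only at this
      simp only [this]
  have hint2 : Integrable (fun r => if ¬ ConfidenceHolds μ (A.armAt s r) r B τ T then (T : ℝ)
      else 0) (rewardLaw μ) :=
    DependsOn.integrable_rewardTable (t := T) fun x y hxy => by
      have := hdepC hxy
      simp only at this
      simp only [this]
  have hint1' := (integrable_finsetSum Finset.univ fun k _ => hint1 k).const_mul (2 * (T : ℝ))
  have hmono := integral_mono (μ := rewardLaw μ)
    (dependsOn_regret μ A s T).integrable_rewardTable
    ((((integrable_const (L * ∑ k, gap μ (s.arm k))).add hint1').add
      (integrable_const ((16 * B + 1) * invGapSum μ))).add hint2) (fun r => by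
        have := regret_le (T := T) (δ := δ) (tie := tie) hL hm htie μ s r hB hi
        simp only [Pi.add_apply, ite_not]
        exact this)
  refine hmono.trans ?_
  rw [integral_add' (((integrable_const _).add hint1').add (integrable_const _)) hint2,
    integral_add' ((integrable_const _).add hint1') (integrable_const _),
    integral_add' (integrable_const _) hint1', integral_const_mul (2 * (T : ℝ)),
    integral_finsetSum _ fun k _ => hint1 k, integral_ite_rewardTable μ hdepC]
  simp only [integral_const, probReal_univ, one_smul]
  have hconf := measureReal_not_confidenceHolds_le μ A s τ T hB
  have hpair : ∀ k, ∫ r, (if s.arm k = i ∧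
      elimLoser α n m T δ tie s r (pairIndex k) = s.arm k then
        gap μ (s.arm (pairPartner k)) else 0) ∂(rewardLaw μ) ≤
      if s.arm k = i then gap μ (s.arm (pairPartner k)) *
        Real.exp (-(L * gap μ (s.arm (pairPartner k)) ^ 2)) else 0 := by
    intro k
    rw [integral_ite_rewardTable μ (hdepE k)]
    split_ifs with h
    · have hg : (μ (s.arm k) : ℝ) - μ (s.arm (pairPartner k)) = gap μ (s.arm (pairPartner k)) := by
        rw [h]
        unfold gap at hi ⊢
        linarith
      have hg0 := gap_nonneg μ (s.arm (pairPartner k))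
      have h1 := measureReal_elimLoser_eq_le (δ := δ) hL hm htie μ s (pairIndex k) (k := k)
        (k' := pairPartner k) rfl (pairPartner_div_two k) (pairPartner_ne k) (by linarith)
      rw [hg] at h1
      rw [mul_comm]
      simp only [h, true_and] at h1 ⊢
      gcongr
    · simp [h]
  rw [mul_comm ((rewardLaw μ).real _) (T : ℝ)]
  gcongr
  exact hpair _

end Elimination

/-! ### Uniform ordered samples -/

section Embedding

variable {κ β : Type*} [Fintype κ] [Fintype β] [DecidableEq β]

/-- In a uniform ordered sample without replacement, each position is uniformly distributed. -/
lemma card_mul_card_embedding_apply_eq (k : κ) (i : β) :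
    Fintype.card β * (Finset.univ.filter fun s : κ ↪ β => s k = i).card =
      Fintype.card (κ ↪ β) := by
  have hsymm : ∀ j, (Finset.univ.filter fun s : κ ↪ β => s k = j).card =
      (Finset.univ.filter fun s : κ ↪ β => s k = i).card := by
    intro j
    refine Finset.card_equiv (Equiv.embeddingCongr (Equiv.refl κ) (Equiv.swap i j)) fun s => ?_
    simp only [Finset.mem_filter, Finset.mem_univ, true_and]
    change s k = j ↔ Equiv.swap i j (s k) = i
    rw [Equiv.swap_apply_eq_iff, Equiv.swap_apply_left]
  have := Finset.card_eq_sum_card_fiberwise (f := fun s : κ ↪ β => s k) (s := Finset.univ)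
    (t := Finset.univ) (fun _ _ => Finset.mem_coe.2 (Finset.mem_univ _))
  simp only [hsymm] at this
  rw [← Finset.card_univ (α := κ ↪ β), this]
  simp

/-- In a uniform ordered sample without replacement, each pair of positions is uniformly
distributed over the pairs of distinct elements. -/
lemma card_mul_card_embedding_apply_eq_apply_eq {k k' : κ} (hk : k ≠ k') {i j : β} (hij : i ≠ j) :
    Fintype.card β * (Fintype.card β - 1) *
        (Finset.univ.filter fun s : κ ↪ β => s k = i ∧ s k' = j).card =
      Fintype.card (κ ↪ β) := by
  have hsymm : ∀ l ∈ Finset.univ.erase i,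
      (Finset.univ.filter fun s : κ ↪ β => s k = i ∧ s k' = l).card =
      (Finset.univ.filter fun s : κ ↪ β => s k = i ∧ s k' = j).card := by
    intro l hl
    have hli : l ≠ i := (Finset.mem_erase.1 hl).1
    refine Finset.card_equiv (Equiv.embeddingCongr (Equiv.refl κ) (Equiv.swap l j)) fun s => ?_
    simp only [Finset.mem_filter, Finset.mem_univ, true_and]
    change s k = i ∧ s k' = l ↔ Equiv.swap l j (s k) = i ∧ Equiv.swap l j (s k') = j
    rw [Equiv.swap_apply_eq_iff, Equiv.swap_apply_eq_iff, Equiv.swap_apply_right,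
      Equiv.swap_apply_of_ne_of_ne hli.symm hij]
  have h := Finset.card_eq_sum_card_fiberwise (f := fun s : κ ↪ β => s k')
    (s := Finset.univ.filter fun s : κ ↪ β => s k = i) (t := Finset.univ.erase i) (by
      intro s hs
      have hs' : s k = i := by simpa using hs
      simp only [Finset.coe_erase, Finset.coe_univ, Set.mem_sdiff, Set.mem_univ, true_and,
        Set.mem_singleton_iff, ← hs']
      exact fun h => hk (s.injective h).symm)
  simp only [Finset.filter_filter] at h
  rw [Finset.sum_congr rfl hsymm, Finset.sum_const, Finset.card_erase_of_mem (Finset.mem_univ _),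
    Finset.card_univ, smul_eq_mul] at h
  rw [mul_assoc, ← h, card_mul_card_embedding_apply_eq]

end Embedding

section PairSample

variable {n m : ℕ}

noncomputable instance PairSample.instFintype : Fintype (PairSample n m) :=
  inferInstanceAs (Fintype (Fin (2 * (n - m)) ↪ {i : Fin n // (i : ℕ) < m}))

instance PairSample.instDiscreteMeasurableSpace : DiscreteMeasurableSpace (PairSample n m) :=
  ⟨fun _ => trivial⟩

lemma card_initial_arms (hm : m + 1 ≤ n) : Fintype.card {i : Fin n // (i : ℕ) < m} = m := by
  rw [Fintype.card_subtype, Fin.card_filter_val_lt]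
  omega

lemma PairSample.nonempty (hm : m + 1 ≤ n) (h : 2 * (n - m) ≤ m) :
    Nonempty (PairSample n m) :=
  Function.Embedding.nonempty_of_card_le (by rw [card_initial_arms hm]; simpa using h)

instance pairSampleLaw.instIsProbabilityMeasure [Nonempty (PairSample n m)] :
    IsProbabilityMeasure (pairSampleLaw n m) :=
  inferInstanceAs (IsProbabilityMeasure (uniformOn Set.univ))

lemma integral_pairSampleLaw [Nonempty (PairSample n m)] (f : PairSample n m → ℝ) :
    ∫ s, f s ∂(pairSampleLaw n m) = (∑ s, f s) / Fintype.card (PairSample n m) := by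
  have hsing : ∀ s, (pairSampleLaw n m).real {s} = 1 / Fintype.card (PairSample n m) := by
    intro s
    rw [measureReal_def, pairSampleLaw, uniformOn_univ]
    simp
  rw [integral_fintype .of_finite, Finset.sum_div]
  refine Finset.sum_congr rfl fun s _ => ?_
  rw [hsing, smul_eq_mul]
  ring

lemma integral_pairSampleLaw_arm_le (hm : m + 1 ≤ n) (h : 2 * (n - m) ≤ m)
    (k : Fin (2 * (n - m))) {f : Fin n → ℝ} (hf : ∀ i, 0 ≤ f i) :
    ∫ s, f (s.arm k) ∂(pairSampleLaw n m) ≤ (∑ i, f i) / m := by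
  classical
  have := PairSample.nonempty hm h
  have hm0 : (0 : ℝ) < m := by exact_mod_cast (show 0 < m by omega)
  have hcard : (0 : ℝ) < Fintype.card (PairSample n m) := by exact_mod_cast Fintype.card_pos
  rw [integral_pairSampleLaw, div_le_div_iff₀ hcard hm0]
  have h1 : ∑ s : PairSample n m, f (s.arm k) = ∑ i : {i : Fin n // (i : ℕ) < m},
      ((Finset.univ.filter fun s : Fin (2 * (n - m)) ↪ {i : Fin n // (i : ℕ) < m} =>
        s k = i).card : ℝ) * f i := by
    rw [← Finset.sum_fiberwise (Finset.univ : Finset (PairSample n m)) (fun s => s.toFun k)]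
    refine Finset.sum_congr rfl fun i _ => ?_
    rw [Finset.sum_congr rfl (g := fun _ => f i) fun s hs => by
      rw [PairSample.arm, (Finset.mem_filter.1 hs).2], Finset.sum_const, nsmul_eq_mul]
    rfl
  have h2 : ∀ i : {i : Fin n // (i : ℕ) < m}, (m : ℝ) *
      ((Finset.univ.filter fun s : Fin (2 * (n - m)) ↪ {i : Fin n // (i : ℕ) < m} =>
        s k = i).card : ℝ) = Fintype.card (PairSample n m) := by
    intro i
    have := card_mul_card_embedding_apply_eq k i
    rw [card_initial_arms hm] at this
    exact_mod_cast this
  rw [h1, Finset.sum_mul, mul_comm (∑ i, f i), Finset.mul_sum]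
  calc _ = ∑ i : {i : Fin n // (i : ℕ) < m}, (Fintype.card (PairSample n m) : ℝ) * f i :=
        Finset.sum_congr rfl fun i _ => by rw [← h2 i]; ring
    _ = ∑ i ∈ Finset.univ.filter fun i : Fin n => (i : ℕ) < m,
        (Fintype.card (PairSample n m) : ℝ) * f i :=
        (Finset.sum_subtype _ (by simp) fun i => (Fintype.card (PairSample n m) : ℝ) * f i).symm
    _ ≤ ∑ i, (Fintype.card (PairSample n m) : ℝ) * f i :=
        Finset.sum_le_sum_of_subset_of_nonneg (Finset.subset_univ _)
          fun i _ _ => mul_nonneg hcard.le (hf i)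

lemma integral_pairSampleLaw_pair_le (hm : m + 1 ≤ n) (h : 2 * (n - m) ≤ m)
    {k k' : Fin (2 * (n - m))} (hk : k ≠ k') (i₀ : Fin n) {f : Fin n → ℝ} (hf : ∀ i, 0 ≤ f i) :
    ∫ s, (if s.arm k = i₀ then f (s.arm k') else 0) ∂(pairSampleLaw n m) ≤
      (∑ i, f i) / (m * (m - 1)) := by
  classical
  have := PairSample.nonempty hm h
  have hm2 : 2 ≤ m := by omega
  have hm2' : (2 : ℝ) ≤ m := by exact_mod_cast hm2
  have hm0 : (0 : ℝ) < m * (m - 1) := by nlinarith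
  have hcard : (0 : ℝ) < Fintype.card (PairSample n m) := by exact_mod_cast Fintype.card_pos
  rw [integral_pairSampleLaw, div_le_div_iff₀ hcard hm0]
  have h1 : ∑ s : PairSample n m, (if s.arm k = i₀ then f (s.arm k') else 0) =
      ∑ i : {i : Fin n // (i : ℕ) < m},
      ((Finset.univ.filter fun s : Fin (2 * (n - m)) ↪ {i : Fin n // (i : ℕ) < m} =>
        (s k : Fin n) = i₀ ∧ s k' = i).card : ℝ) * f i := by
    rw [← Finset.sum_filter, ← Finset.sum_fiberwise _ (fun s : PairSample n m => s.toFun k')]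
    refine Finset.sum_congr rfl fun i _ => ?_
    rw [Finset.sum_congr rfl (g := fun _ => f i) fun s hs => by
      rw [PairSample.arm, (Finset.mem_filter.1 hs).2], Finset.sum_const, nsmul_eq_mul,
      Finset.filter_filter]
    rfl
  have h2 : ∀ i : {i : Fin n // (i : ℕ) < m}, (m * (m - 1) : ℝ) *
      ((Finset.univ.filter fun s : Fin (2 * (n - m)) ↪ {i : Fin n // (i : ℕ) < m} =>
        (s k : Fin n) = i₀ ∧ s k' = i).card : ℝ) ≤ Fintype.card (PairSample n m) := by
    intro i
    by_cases hi₀ : (i₀ : ℕ) < m ∧ i₀ ≠ i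
    · have := card_mul_card_embedding_apply_eq_apply_eq hk (i := (⟨i₀, hi₀.1⟩ : {i : Fin n //
        (i : ℕ) < m})) (j := i) (fun h => hi₀.2 (congrArg Subtype.val h))
      rw [card_initial_arms hm] at this
      simp only [Subtype.ext_iff] at this ⊢
      refine le_of_eq ?_
      have hc : ((m - 1 : ℕ) : ℝ) = (m : ℝ) - 1 := by
        rw [Nat.cast_sub (by omega)]; simp
      rw [← hc]
      exact_mod_cast this
    · rw [Finset.filter_false_of_mem]
      · simp
      · rintro s - ⟨h1, h2⟩
        refine hi₀ ⟨h1 ▸ (s k).2, fun h3 => hk (s.injective (Subtype.ext ?_))⟩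
        rw [h1, h2, h3]
  rw [h1, Finset.sum_mul]
  calc _ ≤ ∑ i : {i : Fin n // (i : ℕ) < m}, (Fintype.card (PairSample n m) : ℝ) * f i := by
        refine Finset.sum_le_sum fun i _ => ?_
        have := mul_le_mul_of_nonneg_right (h2 i) (hf i)
        linarith
    _ = ∑ i ∈ Finset.univ.filter fun i : Fin n => (i : ℕ) < m,
        (Fintype.card (PairSample n m) : ℝ) * f i :=
        (Finset.sum_subtype _ (by simp) fun i => (Fintype.card (PairSample n m) : ℝ) * f i).symm
    _ ≤ ∑ i, (Fintype.card (PairSample n m) : ℝ) * f i :=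
        Finset.sum_le_sum_of_subset_of_nonneg (Finset.subset_univ _)
          fun i _ _ => mul_nonneg hcard.le (hf i)
    _ = _ := by rw [← Finset.mul_sum, mul_comm]

end PairSample

/-! ### Expected regret over the random sample -/

section Elimination

variable {α : ℝ} {n m T : ℕ} {δ : ℝ} {tie : ℕ → Finset (Fin n) → Fin n}

lemma integrable_regret [Nonempty (PairSample n m)] (μ : Fin n → unitInterval)
    (A : StreamingStrategy n (PairSample n m)) (T : ℕ) :
    Integrable (A.regret μ T) ((pairSampleLaw n m).prod (rewardLaw μ)) := by
  have : Countable (PairSample n m) := Finite.to_countable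
  have hmeas : Measurable (A.regret μ T) :=
    measurable_from_prod_countable_right fun s => (dependsOn_regret μ A s T).measurable_rewardTable
  refine Integrable.of_bound hmeas.aestronglyMeasurable T (.of_forall fun ω => ?_)
  have h0 : 0 ≤ A.regret μ T ω := Finset.sum_nonneg fun t _ => gap_nonneg μ _
  rw [Real.norm_of_nonneg h0]
  calc A.regret μ T ω ≤ ∑ t ∈ Finset.range T, (1 : ℝ) :=
        Finset.sum_le_sum fun t _ => gap_le_one μ _
    _ = T := by simp

/-- The sources of regret: the pulls of the elimination phase, the loss of the optimal arm, the UCB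
phase, and the failure of its confidence bounds. -/
lemma integral_regret_prod_le (hL : 0 < elimPulls α n T) (hm : m + 1 ≤ n) (h2 : 2 * (n - m) ≤ m)
    (htie : ∀ (t : ℕ) (S : Finset (Fin n)), S.Nonempty → tie t S ∈ S)
    (μ : Fin n → unitInterval) (hB : 0 ≤ 2 * Real.log (1 / δ)) :
    ∫ ω, (elimUCB α n m T δ tie).regret μ T ω ∂((pairSampleLaw n m).prod (rewardLaw μ)) ≤
      elimPulls α n T * (2 * (n - m : ℕ) * ((∑ i, gap μ i) / m)) +
      2 * T * (2 * (n - m : ℕ) *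
        ((∑ i, gap μ i * Real.exp (-(elimPulls α n T * gap μ i ^ 2))) / (m * (m - 1)))) +
      (16 * (2 * Real.log (1 / δ)) + 1) * invGapSum μ +
      T * (2 * n * T ^ 2 * Real.exp (-(2 * (2 * Real.log (1 / δ))))) := by
  have := PairSample.nonempty hm h2
  obtain ⟨i, hi⟩ := exists_gap_eq_zero μ (show 0 < n by omega)
  rw [integral_prod _ (integrable_regret μ _ T)]
  refine (integral_mono .of_finite .of_finite
    fun s => integral_regret_le hL hm htie μ s hB hi).trans ?_
  rw [integral_add .of_finite .of_finite, integral_add .of_finite .of_finite,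
    integral_add .of_finite .of_finite, integral_const_mul, integral_const_mul,
    integral_finsetSum _ fun _ _ => .of_finite, integral_finsetSum _ fun _ _ => .of_finite]
  simp only [integral_const, probReal_univ, one_smul]
  have hsum : ∀ (f : Fin (2 * (n - m)) → ℝ) (c : ℝ), (∀ k, f k ≤ c) →
      ∑ k, f k ≤ 2 * (n - m : ℕ) * c := fun f c hf => by
    refine (Finset.sum_le_sum fun k _ => hf k).trans (le_of_eq ?_)
    simp
  gcongr
  · exact hsum _ _ fun k => integral_pairSampleLaw_arm_le hm h2 k (gap_nonneg μ)
  · exact hsum _ _ fun k => integral_pairSampleLaw_pair_le hm h2 (pairPartner_ne k) i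
      (f := fun i => gap μ i * Real.exp (-(elimPulls α n T * gap μ i ^ 2)))
      fun i => mul_nonneg (gap_nonneg μ i) (Real.exp_pos _).le

end Elimination

/-! ### Comparison with the regret bound -/

lemma Real.exp_neg_le_rpow {α y : ℝ} (hα : 0 < α) (hy : 0 < y) :
    Real.exp (-y) ≤ (α / Real.exp 1) ^ α * y ^ (-α) := by
  have h1 : y / α ≤ Real.exp (y / α - 1) := by
    have := Real.add_one_le_exp (y / α - 1)
    linarith
  have h2 : (y / α) ^ α ≤ Real.exp (y - α) := by
    calc (y / α) ^ α ≤ Real.exp (y / α - 1) ^ α := by gcongr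
      _ = Real.exp (y - α) := by rw [← Real.exp_mul]; congr 1; field_simp
  rw [Real.div_rpow hy.le hα.le, div_le_iff₀ (by positivity)] at h2
  rw [Real.div_rpow hα.le (Real.exp_pos _).le, ← Real.exp_mul, one_mul, Real.rpow_neg hy.le,
    Real.exp_neg, ← div_eq_mul_inv, div_div, le_div_iff₀ (by positivity),
    inv_mul_le_iff₀ (Real.exp_pos _)]
  calc Real.exp α * y ^ α ≤ Real.exp α * (Real.exp (y - α) * α ^ α) := by gcongr
    _ = Real.exp y * α ^ α := by rw [← mul_assoc, ← Real.exp_add]; congr 2; ring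

section Bound

variable {α : ℝ} {n T : ℕ}

lemma elimPulls_pos (hα : 1 ≤ α) (hn : 0 < n) (hT : 0 < T) : 0 < elimPulls α n T := by
  have hn' : (0 : ℝ) < n := by exact_mod_cast hn
  have hT' : (0 : ℝ) < T := by exact_mod_cast hT
  have hα' : 0 < α := by linarith
  exact Nat.ceil_pos.2 (by positivity)

/-- The loss caused by a partner with gap `g`: the number of elimination pulls is the one for which
`T exp (-L g ^ 2)` and `n L g ^ (-2 α)` are of the same order. -/
lemma mul_gap_mul_exp_le (hα : 1 ≤ α) (hn : 0 < n) (hT : 0 < T) {g : ℝ} (hg : 0 < g) :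
    T * (g * Real.exp (-(elimPulls α n T * g ^ 2))) ≤
      n * ((2 * α / Real.exp 1) ^ (α / (α + 1)) * ((T : ℝ) / n) ^ (1 / (α + 1))) *
        g ^ (1 - 2 * α) := by
  have hn' : (0 : ℝ) < n := by exact_mod_cast hn
  have hT' : (0 : ℝ) < T := by exact_mod_cast hT
  have hα' : 0 < α := by linarith
  set b : ℝ := 2 * α / Real.exp 1 with hb
  have hb0 : 0 < b := by positivity
  set x : ℝ := (T : ℝ) / n with hx
  have hx0 : 0 < x := by positivity
  set Y : ℝ := b ^ (α / (α + 1)) * x ^ (1 / (α + 1)) with hY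
  have hY0 : 0 < Y := by positivity
  have hYL : Y ≤ elimPulls α n T := Nat.le_ceil _
  have h1 : Real.exp (-(elimPulls α n T * g ^ 2)) ≤ b ^ α * (Y ^ (-α) * g ^ (-(2 * α))) := by
    calc Real.exp (-(elimPulls α n T * g ^ 2)) ≤ Real.exp (-(Y * g ^ 2)) := by gcongr
      _ ≤ (α / Real.exp 1) ^ α * (Y * g ^ 2) ^ (-α) := Real.exp_neg_le_rpow hα' (by positivity)
      _ ≤ b ^ α * (Y * g ^ 2) ^ (-α) := by
          gcongr
          rw [hb]
          gcongr
          linarith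
      _ = _ := by
          rw [Real.mul_rpow hY0.le (by positivity), ← Real.rpow_natCast g 2,
            ← Real.rpow_mul hg.le]
          norm_num
  have h2 : b ^ α * Y ^ (-α) * x = Y := by
    rw [hY, Real.mul_rpow (by positivity) (by positivity), ← Real.rpow_mul hb0.le,
      ← Real.rpow_mul hx0.le, ← mul_assoc, ← Real.rpow_add hb0, mul_assoc]
    congr 1
    · congr 1
      field_simp
      ring
    · nth_rewrite 2 [← Real.rpow_one x]
      rw [← Real.rpow_add hx0]
      congr 1
      field_simp
      ring
  have h3 : g * g ^ (-(2 * α)) = g ^ (1 - 2 * α) := by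
    nth_rewrite 1 [← Real.rpow_one g]
    rw [← Real.rpow_add hg, sub_eq_add_neg]
  calc T * (g * Real.exp (-(elimPulls α n T * g ^ 2)))
      ≤ T * (g * (b ^ α * (Y ^ (-α) * g ^ (-(2 * α))))) := by gcongr
    _ = n * (b ^ α * Y ^ (-α) * x) * (g * g ^ (-(2 * α))) := by rw [hx]; field_simp
    _ = _ := by rw [h2, h3]

/-- A power of the horizon dominates the logarithmic regret of the UCB phase. -/
lemma eventually_log_le_rpow {κ p : ℝ} (hκ : 0 < κ) (hp : 0 < p) :
    ∀ᶠ T : ℕ in Filter.atTop, 64 * Real.log T + 2 ≤ κ * (T : ℝ) ^ p := by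
  have h1 : (fun x : ℝ => 64 * Real.log x) =o[Filter.atTop] fun x => x ^ p :=
    (isLittleO_log_rpow_atTop hp).const_mul_left 64
  have h2 : (fun _ : ℝ => (2 : ℝ)) =o[Filter.atTop] fun x => x ^ p :=
    (Asymptotics.isLittleO_const_left.2 (Or.inr
      (tendsto_norm_atTop_atTop.comp (tendsto_rpow_atTop hp))))
  have h3 := (h1.add h2).bound hκ
  filter_upwards [tendsto_natCast_atTop_atTop.eventually h3] with T hT
  rw [Real.norm_of_nonneg (Real.rpow_nonneg (Nat.cast_nonneg _) _)] at hT
  exact (le_abs_self _).trans hT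

lemma elim_term_le {n m c L S Y G : ℝ} (hn : 0 < n) (hnm : 2 / 3 * n ≤ m) (hc : 0 ≤ c)
    (hL : 0 ≤ L) (hLY : L ≤ 2 * Y) (hS : 0 ≤ S) (hSG : S ≤ G) :
    L * (2 * c * (S / m)) ≤ 6 * (c / n * Y * G) := by
  have hm : 0 < m := by linarith
  have hY : 0 ≤ Y := by linarith
  have hG : 0 ≤ G := hS.trans hSG
  calc L * (2 * c * (S / m)) ≤ 2 * Y * (2 * c * (G / (2 / 3 * n))) := by gcongr
    _ = 6 * (c / n * Y * G) := by field_simp; ring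

lemma loss_term_le {n m c T P Y G : ℝ} (hn : 0 < n) (hnm : 2 / 3 * n ≤ m) (hm : 2 ≤ m)
    (hc : 0 ≤ c) (hP : T * P ≤ n * Y * G) (hYG : 0 ≤ n * Y * G) :
    2 * T * (2 * c * (P / (m * (m - 1)))) ≤ 18 * (c / n * Y * G) := by
  have h1 : 2 / 3 * n * (2 / 3 * n / 2) ≤ m * (m - 1) := by
    have : 2 / 3 * n / 2 ≤ m - 1 := by linarith
    gcongr
  have h2 : 0 < m * (m - 1) := lt_of_lt_of_le (by positivity) h1
  calc 2 * T * (2 * c * (P / (m * (m - 1)))) = 4 * c * ((T * P) / (m * (m - 1))) := by ring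
    _ ≤ 4 * c * ((n * Y * G) / (2 / 3 * n * (2 / 3 * n / 2))) := by gcongr
    _ = 18 * (c / n * Y * G) := by field_simp; ring

end Bound

theorem theorem3 :
    ∃ C : ℝ, 0 < C ∧
      ∀ α : ℝ, 1 ≤ α →
      ∀ n m : ℕ, (2 / 3 : ℝ) * (n : ℝ) ≤ (m : ℝ) → m + 1 ≤ n →
      ∃ T₀ : ℕ, ∀ T : ℕ, T₀ ≤ T →
      ∀ δ : ℝ, 1 / (T : ℝ) ^ 2 ≤ δ → δ ≤ 1 / (T : ℝ) →
      ∀ tie : ℕ → Finset (Fin n) → Fin n,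
        (∀ (t : ℕ) (S : Finset (Fin n)), S.Nonempty → tie t S ∈ S) →
        (elimUCB α n m T δ tie).UsesMemory m T ∧
        ∀ μ : Fin n → unitInterval,
          Integrable ((elimUCB α n m T δ tie).regret μ T)
            ((pairSampleLaw n m).prod (rewardLaw μ)) ∧
          ∫ ω, (elimUCB α n m T δ tie).regret μ T ω ∂((pairSampleLaw n m).prod (rewardLaw μ)) ≤
            C * ((2 * α / Real.exp 1) ^ (α / (α + 1)) *
              (((n : ℝ) - (m : ℝ)) * (T : ℝ) ^ (1 / (α + 1)) /
                (n : ℝ) ^ (1 + 1 / (α + 1))) *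
              ∑ i ∈ Finset.univ.filter (fun i : Fin n => 0 < gap μ i),
                gap μ i ^ (1 - 2 * α)) := by
  refine ⟨25, by norm_num, fun α hα n m hnm hm => ?_⟩
  have hα' : 0 < α := by linarith
  have hn : 0 < n := by omega
  have hn' : (0 : ℝ) < n := by exact_mod_cast hn
  have h2 : 2 * (n - m) ≤ m := by
    have : 2 * n ≤ 3 * m := by
      have : (2 * n : ℝ) ≤ 3 * m := by linarith
      exact_mod_cast this
    omega
  have hm2 : (2 : ℝ) ≤ m := by exact_mod_cast (show 2 ≤ m by omega)
  have hc : ((n - m : ℕ) : ℝ) = (n : ℝ) - m := by rw [Nat.cast_sub (by omega)]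
  have hc1 : (1 : ℝ) ≤ (n : ℝ) - m := by rw [← hc]; exact_mod_cast (show 1 ≤ n - m by omega)
  set K : ℝ := (2 * α / Real.exp 1) ^ (α / (α + 1)) with hK
  have hK0 : 0 < K := by positivity
  set p : ℝ := 1 / (α + 1) with hp
  have hp0 : 0 < p := by positivity
  obtain ⟨T₁, hT₁⟩ := Filter.eventually_atTop.1
    (eventually_log_le_rpow (κ := K / n / (n : ℝ) ^ p) (by positivity) hp0)
  refine ⟨max T₁ (2 * n), fun T hT δ hδ1 hδ2 tie htie => ?_⟩
  have hTn : 2 * n ≤ T := (le_max_right _ _).trans hT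
  have hT0 : 0 < T := by omega
  have hT' : (0 : ℝ) < T := by exact_mod_cast hT0
  have hT1 : (1 : ℝ) ≤ T := by exact_mod_cast hT0
  have hL := elimPulls_pos hα hn hT0
  refine ⟨elimUCB_usesMemory hL hm htie, fun μ => ?_⟩
  have hne := PairSample.nonempty hm h2
  refine ⟨integrable_regret μ _ T, ?_⟩
  by_cases hgap : ∃ i, 0 < gap μ i
  swap
  · -- all arms are optimal, and both sides vanish
    push Not at hgap
    have hz : ∀ i, gap μ i = 0 := fun i => le_antisymm (hgap i) (gap_nonneg μ i)
    have hreg : ∀ ω, (elimUCB α n m T δ tie).regret μ T ω = 0 := fun ω =>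
      Finset.sum_eq_zero fun t _ => hz _
    rw [Finset.filter_false_of_mem fun i _ => not_lt.2 (hgap i)]
    simp [hreg]
  have hδ0 : 0 < δ := lt_of_lt_of_le (by positivity) hδ1
  have hlogT : 0 ≤ Real.log T := Real.log_nonneg hT1
  have hlog1 : Real.log T ≤ Real.log (1 / δ) :=
    Real.log_le_log hT' (by rw [le_div_iff₀ hδ0]; rw [le_div_iff₀ hT'] at hδ2; linarith)
  have hlog2 : Real.log (1 / δ) ≤ 2 * Real.log T := by
    have : Real.log (1 / δ) ≤ Real.log ((T : ℝ) ^ 2) := by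
      refine Real.log_le_log (by positivity) ?_
      rw [div_le_iff₀ (by positivity)] at hδ1 ⊢
      linarith
    rwa [Real.log_pow, Nat.cast_ofNat] at this
  set Y : ℝ := K * ((T : ℝ) / n) ^ p with hY
  have hY0 : 0 < Y := by positivity
  have hlogY : 64 * Real.log T + 2 ≤ Y / n := by
    refine (hT₁ T ((le_max_left _ _).trans hT)).trans (le_of_eq ?_)
    rw [hY, Real.div_rpow hT'.le hn'.le]
    ring
  have hY1 : 1 ≤ Y := by
    rw [le_div_iff₀ hn'] at hlogY
    have : (1 : ℝ) ≤ n := by exact_mod_cast hn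
    nlinarith
  have hLY : (elimPulls α n T : ℝ) ≤ 2 * Y := by
    have := Nat.ceil_lt_add_one hY0.le
    change (elimPulls α n T : ℝ) < _ at this
    linarith
  set G : ℝ := ∑ i ∈ Finset.univ.filter (fun i : Fin n => 0 < gap μ i), gap μ i ^ (1 - 2 * α)
    with hG
  -- every sum over the arms is compared with `G` term by term
  have hsum : ∀ {f : Fin n → ℝ} {c : ℝ}, (∀ i, gap μ i = 0 → f i = 0) →
      (∀ i, 0 < gap μ i → f i ≤ c * gap μ i ^ (1 - 2 * α)) → ∑ i, f i ≤ c * G := by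
    intro f c h0 hpos
    rw [hG, Finset.mul_sum, Finset.sum_filter]
    refine Finset.sum_le_sum fun i _ => ?_
    split_ifs with h
    · exact hpos i h
    · exact (h0 i (le_antisymm (not_lt.1 h) (gap_nonneg μ i))).le
  have hinv : ∀ i, 0 < gap μ i → (gap μ i)⁻¹ ≤ gap μ i ^ (1 - 2 * α) := fun i hi => by
    rw [← Real.rpow_neg_one]
    exact Real.rpow_le_rpow_of_exponent_ge hi (gap_le_one μ i) (by linarith)
  have hone : ∀ i, 0 < gap μ i → 1 ≤ (gap μ i)⁻¹ := fun i hi =>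
    (one_le_inv₀ hi).2 (gap_le_one μ i)
  have hS1 : ∑ i, gap μ i ≤ 1 * G := hsum (fun i h => h) fun i hi => by
    have := gap_le_one μ i
    linarith [hinv i hi, hone i hi]
  have hS2 : ∑ i, T * (gap μ i * Real.exp (-(elimPulls α n T * gap μ i ^ 2))) ≤ n * Y * G :=
    hsum (fun i h => by simp [h]) fun i hi => mul_gap_mul_exp_le hα hn hT0 hi
  have hS3 : invGapSum μ ≤ 1 * G := hsum (fun i h => by simp [h]) fun i hi => by
    rw [if_pos hi, one_mul]
    exact hinv i hi
  have hG1 : 1 ≤ G := by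
    obtain ⟨i, hi⟩ := hgap
    refine ((hone i hi).trans (hinv i hi)).trans ?_
    exact Finset.single_le_sum (f := fun i => gap μ i ^ (1 - 2 * α))
      (fun j _ => Real.rpow_nonneg (gap_nonneg μ j) _) (by simpa using hi)
  have hG0 : 0 < G := by linarith
  -- the failure of a confidence bound adds at most `1` to the expected regret
  have hfail : (T : ℝ) * (2 * n * T ^ 2 * Real.exp (-(2 * (2 * Real.log (1 / δ))))) ≤ (1 : ℝ) := by
    have h1 : Real.exp (-(2 * (2 * Real.log (1 / δ)))) ≤ 1 / (T : ℝ) ^ 4 := by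
      have h2 : 1 / (T : ℝ) ^ 4 = Real.exp (-(4 * Real.log T)) := by
        rw [Real.exp_neg, ← Real.log_rpow hT', Real.exp_log (by positivity), one_div]
        norm_cast
      rw [h2]
      exact Real.exp_le_exp.2 (by linarith)
    have h3 : (2 * n : ℝ) ≤ T := by exact_mod_cast hTn
    calc (T : ℝ) * (2 * n * T ^ 2 * Real.exp (-(2 * (2 * Real.log (1 / δ)))))
        ≤ T * (2 * n * T ^ 2 * (1 / (T : ℝ) ^ 4)) := by gcongr
      _ = (2 * n : ℝ) / T := by field_simp
      _ ≤ 1 := (div_le_one hT').2 h3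
  have hmain := integral_regret_prod_le (δ := δ) hL hm h2 htie μ (by linarith)
  rw [hc] at hmain
  set c : ℝ := (n : ℝ) - m with hcdef
  have hc0 : 0 < c := by linarith
  have hrhs : K * (c * (T : ℝ) ^ p / (n : ℝ) ^ (1 + p)) * G = c / n * Y * G := by
    rw [hY, Real.div_rpow hT'.le hn'.le, Real.rpow_add hn', Real.rpow_one]
    field_simp
  rw [hrhs]
  have t1 := elim_term_le (L := elimPulls α n T) hn' hnm hc0.le (by positivity) hLY
    (Finset.sum_nonneg fun i _ => gap_nonneg μ i) (hS1.trans (one_mul G).le)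
  rw [← Finset.mul_sum] at hS2
  have t2 := loss_term_le hn' hnm hm2 hc0.le hS2 (by positivity)
  have t3 : (16 * (2 * Real.log (1 / δ)) + 1) * invGapSum μ + 1 ≤ c / n * Y * G := by
    calc _ ≤ (16 * (2 * (2 * Real.log T)) + 1) * (1 * G) + G := by
          have := invGapSum_nonneg μ
          gcongr
      _ = (64 * Real.log T + 2) * G := by ring
      _ ≤ Y / n * G := by gcongr
      _ = 1 * (Y / n * G) := (one_mul _).symm
      _ ≤ c * (Y / n * G) := by gcongr
      _ = c / n * Y * G := by ring
  linarith
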